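/- Let $A$ be a commutative noetherian local ring with residue field $k$, and let $M$ be a finitely generated $A$-module. A finitely generated $A$-module $C$ is called semi-dualizing if the canonical map $A\to\operatorname{Hom}_A(C,C)$ is an isomorphism and $\operatorname{Ext}^i_A(C,C)=0$ for all $i\ge 1$. The trivial extension $A\ltimes C$ is the ring $A\oplus C$ with product $(a,c)(a_1,c_1)=(aa_1,\,ac_1+ca_1)$, and $M$ is viewed as a module over it through the ring homomorphism $A\ltimes C\to A$, $(a,c)\mapsto a$. A module over a commutative ring $R$ is Gorenstein projective if it is isomorphic to the image of a differential in an exact complex $P=(\cdots\to P_{1}\to P_0\to P_{-1}\to\cdots)$ of projective $R$-modules such that $\operatorname{Hom}_R(P,Q)$ is exact for every projective $R$-module $Q$. The Gorenstein projective dimension $\operatorname{Gpd}_R N$ of a non-zero $R$-module $N$ is the least $n\ge 0$ for which there is an exact sequence $0\to G_n\to\cdots\to G_0\to N\to 0$ with all $G_i$ Gorenstein projective, and $\infty$ if there is no such $n$; moreover $\operatorname{Gpd}_R 0=-\infty$. The Cohen-Macaulay projective dimension of $M$ is $$\operatorname{CMpd}_A M=\inf\{\operatorname{Gpd}_{A\ltimes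 C}M \mid C \text{ is a semi-dualizing } A\text{-module}\},$$ and the depth of an $A$-module $N$ is $\operatorname{depth}_A N=\inf\{i\ge 0\mid \operatorname{Ext}^i_A(k,N)\neq 0\}$ (so $\operatorname{depth}_A 0=\infty$). **Theorem (Auslander-Buchsbaum formula).** If $\operatorname{CMpd}_A M<\infty$, then $$\operatorname{CMpd}_A M=\operatorname{depth}_A A-\operatorname{depth}_A M .$$ -/

import Mathlib

open CategoryTheory

universe u v

/-- A complete projective resolution over `R`: an exact sequence
`⋯ → X (i + 1) → X i → X (i - 1) → ⋯` of projective modules, indexed by `ℤ`, that stays exact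
under `Hom(-, Q)` for every projective module `Q`. -/
structure CompleteProjectiveResolution (R : Type u) [CommRing R] where
  /-- the modules -/
  X : ℤ → ModuleCat.{v} R
  /-- the differential -/
  d : ∀ i : ℤ, X (i + 1) →ₗ[R] X i
  projective : ∀ i : ℤ, Module.Projective R (X i)
  exact : ∀ i : ℤ, Function.Exact (d (i + 1)) (d i)
  hom_exact : ∀ (Q : Type v) [AddCommGroup Q] [Module R Q] [Module.Projective R Q] (i : ℤ),
    Function.Exact (fun f : X i →ₗ[R] Q => f ∘ₗ d i)
      (fun f : X (i + 1) →ₗ[R] Q => f ∘ₗ d (i + 1))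

/-- A module is Gorenstein projective if it is isomorphic to a syzygy (the image of a
differential) of a complete projective resolution. -/
def IsGorensteinProjective (R : Type u) [CommRing R] (N : Type v) [AddCommGroup N]
    [Module R N] : Prop :=
  ∃ P : CompleteProjectiveResolution.{u, v} R, Nonempty (N ≃ₗ[R] LinearMap.range (P.d 0))

/-- `HasGorensteinProjectiveResolution R n N` says that there is an exact sequence
`0 → G_n → ⋯ → G_1 → G_0 → N → 0` of `R`-modules with all `G_i` Gorenstein projective. -/
inductive HasGorensteinProjectiveResolution (R : Type u) [CommRing R] :
    ℕ → ∀ (N : Type v) [AddCommGroup N] [Module R N], Prop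
  | zero (N : Type v) [AddCommGroup N] [Module R N] (hN : IsGorensteinProjective R N) :
      HasGorensteinProjectiveResolution R 0 N
  | succ (n : ℕ) (K G N : Type v) [AddCommGroup K] [Module R K] [AddCommGroup G] [Module R G]
      [AddCommGroup N] [Module R N] (f : K →ₗ[R] G) (g : G →ₗ[R] N)
      (hf : Function.Injective f) (hfg : Function.Exact f g) (hg : Function.Surjective g)
      (hG : IsGorensteinProjective R G) (hK : HasGorensteinProjectiveResolution R n K) :
      HasGorensteinProjectiveResolution R (n + 1) N

open Classical in
/-- The Gorenstein projective dimension of a module: the least length of a resolution by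
Gorenstein projective modules, `∞` if there is no finite one; it is `-∞` for the zero module. -/
noncomputable def gorensteinProjectiveDim (R : Type u) [CommRing R] (N : Type v)
    [AddCommGroup N] [Module R N] : EReal :=
  if Subsingleton N then ⊥
  else sInf {x : EReal | ∃ n : ℕ, HasGorensteinProjectiveResolution R n N ∧ x = (n : EReal)}

/-- A semi-dualizing module: finitely generated, with `A → Hom(C, C)`, `a ↦ (c ↦ a • c)`,
bijective and `Ext^i(C, C) = 0` for all `i ≥ 1`. -/
structure IsSemidualizing (A : Type u) [CommRing A] (C : Type u) [AddCommGroup C]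
    [Module A C] : Prop where
  finite : Module.Finite A C
  bijective : Function.Bijective (LinearMap.lsmul A C)
  ext_eq_zero : ∀ i : ℕ, 1 ≤ i →
    Subsingleton (Abelian.Ext (ModuleCat.of A C) (ModuleCat.of A C) i)

/-- The Gorenstein projective dimension over the trivial extension `A ⋉ C` of the `A`-module `M`,
viewed as a module over `A ⋉ C` through the projection `A ⋉ C → A`, `(a, c) ↦ a`.
(Mathlib's trivial extension asks for a right action on `C`; `IsCentralScalar` says that it is
the given one.) -/
noncomputable def ringChangedGpd (A : Type u) [CommRing A] (C : Type u) [AddCommGroup C]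
    [Module A C] [Module Aᵐᵒᵖ C] [IsCentralScalar A C] (M : Type u) [AddCommGroup M]
    [Module A M] : EReal :=
  letI : Module (TrivSqZeroExt A C) M :=
    Module.compHom M (TrivSqZeroExt.fstHom A A C : TrivSqZeroExt A C →+* A)
  gorensteinProjectiveDim (TrivSqZeroExt A C) M

/-- The Cohen-Macaulay projective dimension of an `A`-module `M`: the infimum over all
semi-dualizing modules `C` of the Gorenstein projective dimension of `M` over `A ⋉ C`. -/
noncomputable def cohenMacaulayProjectiveDim (A : Type u) [CommRing A] (M : Type u)
    [AddCommGroup M] [Module A M] : EReal :=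
  sInf {x : EReal | ∃ (C : Type u) (_ : AddCommGroup C) (_ : Module A C) (_ : Module Aᵐᵒᵖ C)
    (_ : IsCentralScalar A C), IsSemidualizing A C ∧ x = ringChangedGpd A C M}

/-- The depth of a module over a local ring with residue field `k`: the least `i` with
`Ext^i(k, M) ≠ 0`, and `∞` if there is none. -/
noncomputable def moduleDepth (A : Type u) [CommRing A] [IsLocalRing A] (M : Type u)
    [AddCommGroup M] [Module A M] : EReal :=
  sInf {x : EReal | ∃ i : ℕ, Nontrivial (Abelian.Ext
    (ModuleCat.of A (IsLocalRing.ResidueField A)) (ModuleCat.of A M) i) ∧ x = (i : EReal)}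

/-!
For `M = 0` both sides are `-∞`. For `M ≠ 0` the formula holds for each semi-dualizing module `C`
with `Gpd_{A ⋉ C} M < ∞` separately, so that all finite members of the infimum are equal. Put
`R = A ⋉ C`, a noetherian local ring. Instead of comparing depths over `R` and over `A`, all depths
are measured by the groups `Ext_A^j(k, -)` on `R`-modules, restricted to `A` along `a ↦ (a, 0)`;
`M` restricts to the given `A`-module.

*Depth of `R`.* Let `e` be the depth of `C` over `A`, which is finite
(`exists_nontrivial_residueExt`). As `Ext^i(C, C) = 0` for `i ≥ 1`, the functor `Hom(-, C)` turns a
free resolution of `C` into a coresolution of `A = Hom(C, C)` by powers of `C`, and this shows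
that `A` has depth `e` too (`IsSemidualizing.residueExt_ring`). Hence so does `R`, an extension of
`A` by `C`; moreover `Ext_A^e(k, R)` has a nonzero class annihilated by the maximal ideal of `R`.
These two facts are the predicate `HasSocleDepth`. They imply that a map of finite free `R`-modules
that is injective on `Ext_A^e(k, -)` splits (`HasSocleDepth.exists_leftInverse`).

*Gorenstein projective modules.* They form the largest class of modules `N` with
`Ext^i(N, Q) = 0` for `i ≥ 1` and `Q` projective that embed into a projective module with cokernel
in the class (`isGorensteinProjective_of_coinduction`). So they are closed under extensions and
kernels of surjections (`IsGorensteinProjective.of_extension`, `IsGorensteinProjective.of_ker`),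
syzygies of `M` have shorter Gorenstein projective resolutions
(`HasGorensteinProjectiveResolution.syzygy`), and a finitely generated Gorenstein projective module
embeds into a finite free one with Gorenstein projective cokernel
(`IsGorensteinProjective.exists_finite_free_embedding`). This reduces the resolutions, whose
modules need not be finitely generated, to finitely generated modules.

*The formula.* If `G ≠ 0` is finitely generated and Gorenstein projective, dimension shifting along
such embeddings gives depth at least `e`, and `G` is the kernel of a map of finite free modules,
which is not injective on `Ext_A^e(k, -)`, as it would split otherwise; so the depth is `e`. If `M`
has dimension one, there is an exact sequence `0 → R^n → H → M → 0` with `H` Gorenstein projective.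
If `Ext_A^(e-1)(k, M)` vanished, then `R^n → H` would split, and `M` would be Gorenstein projective.
In general, passing to a syzygy lowers the dimension by one and raises the depth by one
(`HasSocleDepth.auslander_buchsbaum`).
-/

/-! ### Long exact sequences for `Ext` out of an object, along an exact functor -/

section ExtAlong

open Abelian Limits

universe w w' v'

variable {R : Type u} [CommRing R] {D : Type w'} [Category.{v'} D] [Abelian D]

lemma shortExact_map (F : ModuleCat.{u} R ⥤ D) [F.Additive] [PreservesFiniteLimits F]
    [PreservesFiniteColimits F] {X Y Z : Type u} [AddCommGroup X] [Module R X] [AddCommGroup Y]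
    [Module R Y] [AddCommGroup Z] [Module R Z] {f : X →ₗ[R] Y} {g : Y →ₗ[R] Z}
    (hf : Function.Injective f) (hfg : Function.Exact f g) (hg : Function.Surjective g) :
    ((ModuleCat.shortComplexOfCompEqZero f g hfg.linearMap_comp_eq_zero).map F).ShortExact :=
  (ModuleCat.shortComplex_shortExact _ hfg hf hg).map_of_exact F

variable [HasExt.{w} D]

/-- The groups `Ext^j(K, F N)` for an `R`-module `N` and a functor `F` from `R`-modules to an
abelian category. It is used for the identity functor and for restriction of scalars. -/
abbrev ExtAlong (F : ModuleCat.{u} R ⥤ D) (K : D) (N : Type u) [AddCommGroup N] [Module R N]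
    (j : ℕ) : Type w :=
  Ext K (F.obj (ModuleCat.of R N)) j

namespace ExtAlong

variable (F : ModuleCat.{u} R ⥤ D) (K : D)
variable {X Y Z : Type u} [AddCommGroup X] [Module R X] [AddCommGroup Y] [Module R Y]
  [AddCommGroup Z] [Module R Z]

/-- The map `Ext^j(K, F X) → Ext^j(K, F Y)` induced by an `R`-linear map `X → Y`. -/
noncomputable def map (j : ℕ) (f : X →ₗ[R] Y) : ExtAlong F K X j →+ ExtAlong F K Y j :=
  (Ext.mk₀ (F.map (ModuleCat.ofHom f))).postcomp K (add_zero j)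

lemma map_apply (j : ℕ) (f : X →ₗ[R] Y) (x : ExtAlong F K X j) :
    map F K j f x = x.comp (Ext.mk₀ (F.map (ModuleCat.ofHom f))) (add_zero j) := rfl

lemma map_comp_apply (j : ℕ) (f : X →ₗ[R] Y) (g : Y →ₗ[R] Z) (x : ExtAlong F K X j) :
    map F K j (g ∘ₗ f) x = map F K j g (map F K j f x) := by
  simp [map_apply, ModuleCat.ofHom_comp]

lemma map_id_apply (j : ℕ) (x : ExtAlong F K X j) : map F K j LinearMap.id x = x := by
  have : ModuleCat.ofHom (LinearMap.id : X →ₗ[R] X) = 𝟙 _ := rfl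
  simp [map_apply, this]

lemma subsingleton_of_equiv (j : ℕ) (e : X ≃ₗ[R] Y) (h : Subsingleton (ExtAlong F K X j)) :
    Subsingleton (ExtAlong F K Y j) := by
  refine subsingleton_of_forall_eq 0 fun y => ?_
  rw [← map_id_apply F K j y, ← e.comp_symm, map_comp_apply,
    Subsingleton.elim (map F K j e.symm.toLinearMap y) 0, map_zero]

lemma map_unit_smul_ne_zero (j : ℕ) {r : R} (hr : IsUnit r) {x : ExtAlong F K X j} (hx : x ≠ 0) :
    map F K j (r • LinearMap.id) x ≠ 0 := by
  intro h
  obtain ⟨r, rfl⟩ := hr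
  apply hx
  have : (((r⁻¹ : Rˣ) : R) • LinearMap.id : X →ₗ[R] X) ∘ₗ ((r : R) • LinearMap.id) =
      LinearMap.id := LinearMap.ext fun x => by simp [smul_smul]
  rw [← map_id_apply F K j x, ← this, map_comp_apply, h, map_zero]

section Additive

variable [F.Additive]

lemma map_zero_apply (j : ℕ) (x : ExtAlong F K X j) : map F K j (0 : X →ₗ[R] Y) x = 0 := by
  have : ModuleCat.ofHom (0 : X →ₗ[R] Y) = 0 := rfl
  simp [map_apply, this]

lemma subsingleton_of_subsingleton [Subsingleton X] (j : ℕ) :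
    Subsingleton (ExtAlong F K X j) := by
  refine subsingleton_of_forall_eq 0 fun x => ?_
  rw [← map_id_apply F K j x, Subsingleton.elim (LinearMap.id : X →ₗ[R] X) 0, map_zero_apply]

lemma map_add_apply (j : ℕ) (f g : X →ₗ[R] Y) (x : ExtAlong F K X j) :
    map F K j (f + g) x = map F K j f x + map F K j g x := by
  have : ModuleCat.ofHom (f + g) = ModuleCat.ofHom f + ModuleCat.ofHom g := rfl
  simp [map_apply, this, F.map_add, Ext.mk₀_add]

lemma map_sum_apply {ι : Type*} (s : Finset ι) (j : ℕ) (f : ι → X →ₗ[R] Y)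
    (x : ExtAlong F K X j) : map F K j (∑ i ∈ s, f i) x = ∑ i ∈ s, map F K j (f i) x := by
  classical
  induction s using Finset.induction_on with
  | empty => simp [map_zero_apply]
  | insert a s ha ih => simp [Finset.sum_insert ha, map_add_apply, ih]

/-- A class in `Ext^j(K, F X)` vanishes if its images under the projections of a finite direct sum
decomposition of `X` do. -/
lemma eq_zero_of_decomposition {ι : Type*} [Fintype ι] {W : ι → Type u}
    [∀ i, AddCommGroup (W i)] [∀ i, Module R (W i)] (p : ∀ i, X →ₗ[R] W i)
    (q : ∀ i, W i →ₗ[R] X) (hpq : ∑ i, q i ∘ₗ p i = LinearMap.id) (j : ℕ)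
    (x : ExtAlong F K X j) (hx : ∀ i, map F K j (p i) x = 0) : x = 0 := by
  rw [← map_id_apply F K j x, ← hpq, map_sum_apply]
  exact Finset.sum_eq_zero fun i _ => by rw [map_comp_apply, hx, map_zero]

lemma eq_zero_of_forall_proj {n j : ℕ} (x : ExtAlong F K (Fin n → X) j)
    (hx : ∀ i, map F K j (LinearMap.proj i) x = 0) : x = 0 := by
  refine eq_zero_of_decomposition F K (W := fun _ => X) (fun i => LinearMap.proj i)
    (fun i => LinearMap.single R (fun _ => X) i) ?_ j x hx
  refine LinearMap.ext fun y => ?_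
  simpa using Finset.univ_sum_single y

lemma subsingleton_pi {n j : ℕ} (h : Subsingleton (ExtAlong F K X j)) :
    Subsingleton (ExtAlong F K (Fin n → X) j) :=
  subsingleton_of_forall_eq 0 fun x => eq_zero_of_forall_proj F K x fun _ => Subsingleton.elim _ _

end Additive

section Exact

variable [F.Additive] [PreservesFiniteLimits F] [PreservesFiniteColimits F]
variable {f : X →ₗ[R] Y} {g : Y →ₗ[R] Z}

lemma exists_map_eq (hf : Function.Injective f) (hfg : Function.Exact f g)
    (hg : Function.Surjective g) {j : ℕ} (y : ExtAlong F K Y j) (hy : map F K j g y = 0) :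
    ∃ x : ExtAlong F K X j, map F K j f x = y :=
  Ext.covariant_sequence_exact₂ K (shortExact_map F hf hfg hg) y hy

lemma subsingleton_middle (hf : Function.Injective f) (hfg : Function.Exact f g)
    (hg : Function.Surjective g) {j : ℕ} (hX : Subsingleton (ExtAlong F K X j))
    (hZ : Subsingleton (ExtAlong F K Z j)) : Subsingleton (ExtAlong F K Y j) := by
  refine subsingleton_of_forall_eq 0 fun y => ?_
  obtain ⟨x, rfl⟩ := exists_map_eq F K hf hfg hg y (Subsingleton.elim _ _)
  rw [Subsingleton.elim x 0, map_zero]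

lemma subsingleton_right (hf : Function.Injective f) (hfg : Function.Exact f g)
    (hg : Function.Surjective g) {j : ℕ} (hY : Subsingleton (ExtAlong F K Y j))
    (hX : Subsingleton (ExtAlong F K X (j + 1))) : Subsingleton (ExtAlong F K Z j) := by
  refine subsingleton_of_forall_eq 0 fun z => ?_
  obtain ⟨y, rfl⟩ := Ext.covariant_sequence_exact₃ K (shortExact_map F hf hfg hg) z rfl
    (hX.elim _ _)
  obtain rfl : y = 0 := hY.elim y 0
  apply Ext.zero_comp

/-- For `j = 0` there is no condition on `Z`. -/
lemma map_injective (hf : Function.Injective f) (hfg : Function.Exact f g)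
    (hg : Function.Surjective g) {j : ℕ}
    (hZ : ∀ i, i + 1 = j → Subsingleton (ExtAlong F K Z i)) :
    Function.Injective (map F K j f) := by
  have hS := shortExact_map F hf hfg hg
  cases j with
  | zero =>
    have := hS.mono_f
    exact Ext.postcomp_mk₀_injective_of_mono K
      ((ModuleCat.shortComplexOfCompEqZero f g hfg.linearMap_comp_eq_zero).map F).f
  | succ i =>
    refine (injective_iff_map_eq_zero _).2 fun x hx => ?_
    obtain ⟨z, rfl⟩ := Ext.covariant_sequence_exact₁ K hS x hx rfl
    obtain rfl : z = 0 := (hZ i rfl).elim z 0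
    apply Ext.zero_comp

lemma subsingleton_left (hf : Function.Injective f) (hfg : Function.Exact f g)
    (hg : Function.Surjective g) {j : ℕ}
    (hZ : ∀ i, i + 1 = j → Subsingleton (ExtAlong F K Z i))
    (hY : Subsingleton (ExtAlong F K Y j)) : Subsingleton (ExtAlong F K X j) :=
  (map_injective F K hf hfg hg hZ).subsingleton

end Exact

end ExtAlong

end ExtAlong

/-! ### Vanishing of `Ext` into projective modules -/

section ProjOrth

open Abelian

variable {R : Type u} [CommRing R]
variable {X Y Z : Type u} [AddCommGroup X] [Module R X] [AddCommGroup Y] [Module R Y]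
  [AddCommGroup Z] [Module R Z] {f : X →ₗ[R] Y} {g : Y →ₗ[R] Z}

lemma subsingleton_ext_of_projective (P Q : Type u) [AddCommGroup P] [Module R P]
    [Module.Projective R P] [AddCommGroup Q] [Module R Q] (j : ℕ) :
    Subsingleton (Ext (ModuleCat.of R P) (ModuleCat.of R Q) (j + 1)) := by
  have := (IsProjective.iff_projective (R := R) P).1 inferInstance
  exact Ext.subsingleton_of_projective _ _ _

lemma subsingleton_ext_middle (hf : Function.Injective f) (hfg : Function.Exact f g)
    (hg : Function.Surjective g) {Q : ModuleCat.{u} R} {j : ℕ}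
    (hX : Subsingleton (Ext (ModuleCat.of R X) Q j))
    (hZ : Subsingleton (Ext (ModuleCat.of R Z) Q j)) :
    Subsingleton (Ext (ModuleCat.of R Y) Q j) := by
  refine subsingleton_of_forall_eq 0 fun y => ?_
  obtain ⟨z, rfl⟩ := Ext.contravariant_sequence_exact₂
    (ModuleCat.shortComplex_shortExact (ModuleCat.shortComplexOfCompEqZero f g
      hfg.linearMap_comp_eq_zero) hfg hf hg) Q y (hX.elim _ _)
  rw [hZ.elim z 0, Ext.comp_zero]

lemma subsingleton_ext_left (hf : Function.Injective f) (hfg : Function.Exact f g)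
    (hg : Function.Surjective g) {Q : ModuleCat.{u} R} {j : ℕ}
    (hY : Subsingleton (Ext (ModuleCat.of R Y) Q j))
    (hZ : Subsingleton (Ext (ModuleCat.of R Z) Q (j + 1))) :
    Subsingleton (Ext (ModuleCat.of R X) Q j) := by
  refine subsingleton_of_forall_eq 0 fun x => ?_
  obtain ⟨y, rfl⟩ := Ext.contravariant_sequence_exact₁
    (ModuleCat.shortComplex_shortExact (ModuleCat.shortComplexOfCompEqZero f g
      hfg.linearMap_comp_eq_zero) hfg hf hg) Q x (add_comm 1 j) (hZ.elim _ _)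
  rw [hY.elim y 0, Ext.comp_zero]

lemma subsingleton_ext_right (hf : Function.Injective f) (hfg : Function.Exact f g)
    (hg : Function.Surjective g) {Q : ModuleCat.{u} R} {j : ℕ}
    (hX : Subsingleton (Ext (ModuleCat.of R X) Q j))
    (hY : Subsingleton (Ext (ModuleCat.of R Y) Q (j + 1))) :
    Subsingleton (Ext (ModuleCat.of R Z) Q (j + 1)) := by
  refine subsingleton_of_forall_eq 0 fun z => ?_
  obtain ⟨x, rfl⟩ := Ext.contravariant_sequence_exact₃
    (ModuleCat.shortComplex_shortExact (ModuleCat.shortComplexOfCompEqZero f g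
      hfg.linearMap_comp_eq_zero) hfg hf hg) Q z (hY.elim _ _) (add_comm 1 j)
  rw [hX.elim x 0, Ext.comp_zero]

/-- Maps extend along an injection if `Ext^1` of its cokernel vanishes. -/
lemma exists_extension_of_ext (hf : Function.Injective f) (hfg : Function.Exact f g)
    (hg : Function.Surjective g) {Q : Type u} [AddCommGroup Q] [Module R Q]
    (hZ : Subsingleton (Ext (ModuleCat.of R Z) (ModuleCat.of R Q) 1)) (h : X →ₗ[R] Q) :
    ∃ h' : Y →ₗ[R] Q, h' ∘ₗ f = h := by
  obtain ⟨y, hy⟩ := Ext.contravariant_sequence_exact₁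
    (ModuleCat.shortComplex_shortExact (ModuleCat.shortComplexOfCompEqZero f g
      hfg.linearMap_comp_eq_zero) hfg hf hg) (ModuleCat.of R Q) (Ext.mk₀ (ModuleCat.ofHom h))
      (add_zero 1) (hZ.elim _ _)
  obtain ⟨y, rfl⟩ := (Ext.mk₀_bijective _ _).2 y
  rw [Ext.mk₀_comp_mk₀, (Ext.mk₀_bijective _ _).1.eq_iff] at hy
  exact ⟨y.hom, congrArg ModuleCat.Hom.hom hy⟩

/-- Conversely, `Ext^1` of the cokernel vanishes if maps extend and `Ext^1` of the middle term
vanishes. -/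
lemma subsingleton_ext_one_of_forall_extension (hf : Function.Injective f)
    (hfg : Function.Exact f g) (hg : Function.Surjective g) {Q : Type u} [AddCommGroup Q]
    [Module R Q]
    (hY : Subsingleton (Ext (ModuleCat.of R Y) (ModuleCat.of R Q) 1))
    (h : ∀ h : X →ₗ[R] Q, ∃ h' : Y →ₗ[R] Q, h' ∘ₗ f = h) :
    Subsingleton (Ext (ModuleCat.of R Z) (ModuleCat.of R Q) 1) := by
  refine subsingleton_of_forall_eq 0 fun z => ?_
  have hS := ModuleCat.shortComplex_shortExact (ModuleCat.shortComplexOfCompEqZero f g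
      hfg.linearMap_comp_eq_zero) hfg hf hg
  obtain ⟨x, rfl⟩ := Ext.contravariant_sequence_exact₃ hS (ModuleCat.of R Q) z (hY.elim _ _)
    (add_zero 1)
  obtain ⟨x, rfl⟩ := (Ext.mk₀_bijective _ _).2 x
  obtain ⟨h', hh'⟩ := h x.hom
  have : x = (ModuleCat.shortComplexOfCompEqZero f g hfg.linearMap_comp_eq_zero).f ≫
      ModuleCat.ofHom h' := ModuleCat.hom_ext hh'.symm
  rw [this, ← Ext.mk₀_comp_mk₀, ShortComplex.ShortExact.extClass_comp_assoc]

variable (R) in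
/-- A module `N` is orthogonal to the projective modules if `Ext^i(N, Q) = 0` for all `i ≥ 1` and
all projective `Q`. -/
def ProjOrth (N : Type u) [AddCommGroup N] [Module R N] : Prop :=
  ∀ (Q : Type u) [AddCommGroup Q] [Module R Q] [Module.Projective R Q] (i : ℕ),
    Subsingleton (Ext (ModuleCat.of R N) (ModuleCat.of R Q) (i + 1))

lemma ProjOrth.of_projective (P : Type u) [AddCommGroup P] [Module R P] [Module.Projective R P] :
    ProjOrth R P := fun Q _ _ _ i => subsingleton_ext_of_projective P Q i

lemma ProjOrth.middle (hf : Function.Injective f) (hfg : Function.Exact f g)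
    (hg : Function.Surjective g) (hX : ProjOrth R X) (hZ : ProjOrth R Z) : ProjOrth R Y :=
  fun Q _ _ _ i => subsingleton_ext_middle hf hfg hg (hX Q i) (hZ Q i)

lemma ProjOrth.left (hf : Function.Injective f) (hfg : Function.Exact f g)
    (hg : Function.Surjective g) (hY : ProjOrth R Y) (hZ : ProjOrth R Z) : ProjOrth R X :=
  fun Q _ _ _ i => subsingleton_ext_left hf hfg hg (hY Q i) (hZ Q (i + 1))

lemma ProjOrth.exists_extension (hf : Function.Injective f) (hfg : Function.Exact f g)
    (hg : Function.Surjective g) (hZ : ProjOrth R Z) {Q : Type u} [AddCommGroup Q] [Module R Q]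
    [Module.Projective R Q] (h : X →ₗ[R] Q) : ∃ h' : Y →ₗ[R] Q, h' ∘ₗ f = h :=
  exists_extension_of_ext hf hfg hg (hZ Q 0) h

lemma ProjOrth.of_equiv (e : X ≃ₗ[R] Y) (hX : ProjOrth R X) : ProjOrth R Y :=
  fun Q _ _ _ i => by
    have := ProjOrth.of_projective (R := R) PUnit.{u + 1}
    exact subsingleton_ext_middle (f := e.toLinearMap) (g := (0 : Y →ₗ[R] PUnit.{u + 1}))
      e.injective (fun y => by simp) (fun z => ⟨0, rfl⟩) (hX Q i) (this Q i)

end ProjOrth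

/-! ### Gorenstein projective modules as a greatest fixed point -/

section GorensteinProjective

variable {R : Type u} [CommRing R]

/-- A linear map that vanishes on the kernel of a surjection factors through it. -/
lemma exists_factor_of_surjective {X Y Z : Type u} [AddCommGroup X] [Module R X] [AddCommGroup Y]
    [Module R Y] [AddCommGroup Z] [Module R Z] {g : X →ₗ[R] Y} (hg : Function.Surjective g)
    (h : X →ₗ[R] Z) (H : ∀ x, g x = 0 → h x = 0) : ∃ h' : Y →ₗ[R] Z, ∀ x, h' (g x) = h x := by
  refine ⟨(LinearMap.ker g).liftQ h H ∘ₗ (g.quotKerEquivOfSurjective hg).symm.toLinearMap,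
    fun x => ?_⟩
  have : (g.quotKerEquivOfSurjective hg).symm (g x) = Submodule.Quotient.mk x := by
    rw [LinearEquiv.symm_apply_eq]
    rfl
  simp only [LinearMap.comp_apply, LinearEquiv.coe_coe, this]
  rfl

variable (R) in
/-- `N` embeds into a projective module with cokernel isomorphic to `W`. -/
def HasCosyzygy (N W : Type u) [AddCommGroup N] [Module R N] [AddCommGroup W] [Module R W] :
    Prop :=
  ∃ (P : Type u) (_ : AddCommGroup P) (_ : Module R P) (_ : Module.Projective R P)
    (f : N →ₗ[R] P) (g : P →ₗ[R] W),
    Function.Injective f ∧ Function.Exact f g ∧ Function.Surjective g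

lemma hasCosyzygy_ker (N : Type u) [AddCommGroup N] [Module R N] :
    ∃ (K : Type u) (_ : AddCommGroup K) (_ : Module R K), HasCosyzygy R K N := by
  let g := Finsupp.linearCombination R (id : N → N)
  refine ⟨LinearMap.ker g, inferInstance, inferInstance, N →₀ R, inferInstance, inferInstance,
    inferInstance, (LinearMap.ker g).subtype, g, Subtype.val_injective,
    LinearMap.exact_subtype_ker_map g, Finsupp.linearCombination_id_surjective R N⟩

/-- Splicing short exact sequences with projective middle terms, all of whose end terms are
orthogonal to the projective modules, gives a complete projective resolution. -/
lemma isGorensteinProjective_of_family (T : ℤ → ModuleCat.{u} R)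
    (hT : ∀ i, ProjOrth R (T i)) (hstep : ∀ i, HasCosyzygy R (T (i + 1)) (T i)) :
    IsGorensteinProjective R (T 1) := by
  choose P _ _ _ f g hf hfg hg using hstep
  let C : CompleteProjectiveResolution.{u, u} R :=
    { X := fun i => ModuleCat.of R (P i)
      d := fun i => f i ∘ₗ g (i + 1)
      projective := fun i => inferInstanceAs (Module.Projective R (P i))
      exact := fun i x => by
        constructor
        · intro hx
          obtain ⟨t, rfl⟩ := (hfg (i + 1) x).1 (hf i (hx.trans (map_zero (f i)).symm))
          obtain ⟨y, rfl⟩ := hg (i + 1 + 1) t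
          exact ⟨y, rfl⟩
        · rintro ⟨y, rfl⟩
          change f i (g (i + 1) (f (i + 1) _)) = 0
          rw [(hfg (i + 1)).apply_apply_eq_zero, map_zero]
      hom_exact := fun Q _ _ _ i h => by
        constructor
        · intro hh
          have hh' : ∀ x, h (f (i + 1) x) = 0 := fun x => by
            obtain ⟨y, rfl⟩ := hg (i + 1 + 1) x
            exact LinearMap.congr_fun hh y
          -- `h` factors through `g (i + 1)`, and the factor extends along `f i`
          obtain ⟨h₁, hh₁⟩ := exists_factor_of_surjective (hg (i + 1)) h (fun x hx => by
            obtain ⟨t, rfl⟩ := (hfg (i + 1) x).1 hx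
            exact hh' t)
          obtain ⟨h₂, hh₂⟩ := (hT i).exists_extension (hf i) (hfg i) (hg i) h₁
          refine ⟨h₂, LinearMap.ext fun x => ?_⟩
          change h₂ (f i (g (i + 1) x)) = h x
          rw [← LinearMap.comp_apply h₂, hh₂, hh₁]
        · rintro ⟨h₂, rfl⟩
          refine LinearMap.ext fun x => ?_
          change h₂ (f i (g (i + 1) (f (i + 1) _))) = 0
          rw [(hfg (i + 1)).apply_apply_eq_zero, map_zero, map_zero] }
  have hr : LinearMap.range (f 0) = LinearMap.range (C.d 0) :=
    (LinearMap.range_comp_of_range_eq_top (f 0) (LinearMap.range_eq_top.2 (hg (0 + 1)))).symm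
  exact ⟨C, ⟨(LinearEquiv.ofInjective (f 0) (hf 0)).trans (LinearEquiv.ofEq _ _ hr)⟩⟩

/-- The class of Gorenstein projective modules is the largest class of modules `N` that are
orthogonal to the projective modules and embed into a projective module with cokernel in the
class: this is the half that produces Gorenstein projective modules. -/
theorem isGorensteinProjective_of_coinduction (S : ModuleCat.{u} R → Prop)
    (hS : ∀ N, S N → ProjOrth R N ∧ ∃ W, S W ∧ HasCosyzygy R N W)
    (N : Type u) [AddCommGroup N] [Module R N] (hN : S (ModuleCat.of R N)) :
    IsGorensteinProjective R N := by
  choose! hO next hnext using hS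
  let Z : ℕ → {N : ModuleCat.{u} R // S N} := fun n =>
    n.rec ⟨_, hN⟩ fun _ W => ⟨next W, (hnext _ W.2).1⟩
  have left : ∀ W : {W : ModuleCat.{u} R // ProjOrth R W},
      ∃ K : {W : ModuleCat.{u} R // ProjOrth R W}, HasCosyzygy R K.1 W.1 := fun W => by
    obtain ⟨K, _, _, hK⟩ := hasCosyzygy_ker (R := R) W.1
    obtain ⟨P, _, _, _, f, g, hf, hfg, hg⟩ := id hK
    exact ⟨⟨ModuleCat.of R K, ProjOrth.left hf hfg hg (ProjOrth.of_projective P) W.2⟩, hK⟩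
  choose prev hprev using left
  let Y : ℕ → {W : ModuleCat.{u} R // ProjOrth R W} := fun n =>
    n.rec ⟨_, hO _ hN⟩ fun _ W => prev W
  let T : ℤ → ModuleCat.{u} R := fun i =>
    match i with
    | Int.ofNat 0 => (Z 1).1
    | Int.ofNat (n + 1) => (Y n).1
    | Int.negSucc n => (Z (n + 2)).1
  refine isGorensteinProjective_of_family T (fun i => ?_) (fun i => ?_)
  · match i with
    | Int.ofNat 0 => exact hO _ (Z 1).2
    | Int.ofNat (n + 1) => exact (Y n).2
    | Int.negSucc n => exact hO _ (Z (n + 2)).2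
  · match i with
    | Int.ofNat 0 => exact (hnext _ (Z 0).2).2
    | Int.ofNat (n + 1) => exact hprev (Y n)
    | Int.negSucc 0 => exact (hnext _ (Z 1).2).2
    | Int.negSucc (n + 1) => exact (hnext _ (Z (n + 2)).2).2

lemma HasCosyzygy.of_equiv {N N' W W' : Type u} [AddCommGroup N] [Module R N] [AddCommGroup W]
    [Module R W] [AddCommGroup N'] [Module R N'] [AddCommGroup W'] [Module R W']
    (e : N' ≃ₗ[R] N) (e' : W ≃ₗ[R] W') (h : HasCosyzygy R N W) : HasCosyzygy R N' W' := by
  obtain ⟨P, _, _, _, f, g, hf, hfg, hg⟩ := h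
  refine ⟨P, _, _, ‹_›, f ∘ₗ e.toLinearMap, e'.toLinearMap ∘ₗ g, hf.comp e.injective, fun x => ?_,
    e'.surjective.comp hg⟩
  simp only [LinearMap.comp_apply, LinearEquiv.coe_coe, map_eq_zero_iff e' e'.injective, hfg x,
    Set.mem_range]
  exact e.surjective.exists

namespace CompleteProjectiveResolution

variable (C : CompleteProjectiveResolution.{u, u} R)

lemma exact_rangeRestrict (i : ℤ) :
    Function.Exact (LinearMap.range (C.d (i + 1))).subtype (C.d i).rangeRestrict := by
  intro x
  have := C.exact i x
  rw [← Subtype.coe_inj]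
  simpa using this

lemma hasCosyzygy {i j : ℤ} (hj : j = i + 1) :
    HasCosyzygy R (LinearMap.range (C.d j)) (LinearMap.range (C.d i)) := by
  subst hj
  exact ⟨C.X (i + 1), inferInstance, inferInstance, C.projective _, _, _, Subtype.val_injective,
    C.exact_rangeRestrict i, (C.d i).surjective_rangeRestrict⟩

lemma projOrth (i : ℤ) : ProjOrth R (LinearMap.range (C.d i)) := by
  intro Q _ _ _ n
  have := C.projective (i + 1)
  induction n generalizing i with
  | zero =>
    refine subsingleton_ext_one_of_forall_extension Subtype.val_injective (C.exact_rangeRestrict i)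
      (C.d i).surjective_rangeRestrict (subsingleton_ext_of_projective _ Q 0) fun h => ?_
    obtain ⟨h', hh'⟩ := (C.hom_exact Q (i + 1) (h ∘ₗ (C.d (i + 1)).rangeRestrict)).1 (by
      refine LinearMap.ext fun x => ?_
      have : (C.d (i + 1)).rangeRestrict (C.d (i + 1 + 1) x) = 0 :=
        Subtype.ext ((C.exact (i + 1)).apply_apply_eq_zero x)
      simp [this])
    refine ⟨h', LinearMap.ext ?_⟩
    rintro ⟨_, x, rfl⟩
    exact LinearMap.congr_fun hh' x
  | succ n ih =>
    exact subsingleton_ext_right Subtype.val_injective (C.exact_rangeRestrict i)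
      (C.d i).surjective_rangeRestrict (ih (i + 1) (C.projective _))
      (subsingleton_ext_of_projective _ Q _)

lemma isGorensteinProjective_range (i : ℤ) :
    IsGorensteinProjective R (LinearMap.range (C.d i)) := by
  refine isGorensteinProjective_of_coinduction
    (fun N => ∃ i, Nonempty (N ≃ₗ[R] LinearMap.range (C.d i))) ?_ _ ⟨i, ⟨LinearEquiv.refl R _⟩⟩
  rintro N ⟨i, ⟨e⟩⟩
  obtain ⟨i, rfl⟩ : ∃ j, i = j + 1 := ⟨i - 1, by ring⟩
  exact ⟨(C.projOrth (i + 1)).of_equiv e.symm, ModuleCat.of R (LinearMap.range (C.d i)),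
    ⟨i, ⟨LinearEquiv.refl R _⟩⟩, (C.hasCosyzygy rfl).of_equiv e (LinearEquiv.refl R _)⟩

end CompleteProjectiveResolution

namespace IsGorensteinProjective

variable {N G₁ G₂ : Type u} [AddCommGroup N] [Module R N] [AddCommGroup G₁] [Module R G₁]
  [AddCommGroup G₂] [Module R G₂]

lemma of_equiv (e : N ≃ₗ[R] G₁) (h : IsGorensteinProjective R N) : IsGorensteinProjective R G₁ := by
  obtain ⟨P, ⟨e'⟩⟩ := h
  exact ⟨P, ⟨e.symm.trans e'⟩⟩

lemma projOrth (h : IsGorensteinProjective R N) : ProjOrth R N := by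
  obtain ⟨C, ⟨e⟩⟩ := h
  exact (C.projOrth 0).of_equiv e.symm

lemma exists_cosyzygy (h : IsGorensteinProjective R N) :
    ∃ W : ModuleCat.{u} R, IsGorensteinProjective R W ∧ HasCosyzygy R N W := by
  obtain ⟨C, ⟨e⟩⟩ := h
  exact ⟨ModuleCat.of R (LinearMap.range (C.d (-1))), C.isGorensteinProjective_range (-1),
    (C.hasCosyzygy (by norm_num)).of_equiv e (LinearEquiv.refl R _)⟩

lemma of_projective (P : Type u) [AddCommGroup P] [Module R P] [Module.Projective R P] :
    IsGorensteinProjective R P := by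
  refine isGorensteinProjective_of_coinduction (fun N => Module.Projective R N) ?_ P ‹_›
  intro N hN
  refine ⟨ProjOrth.of_projective N, ModuleCat.of R PUnit.{u + 1},
    inferInstanceAs (Module.Projective R PUnit.{u + 1}), N, inferInstance, inferInstance, hN,
    LinearMap.id, 0, Function.injective_id, fun x => by simp, fun z => ⟨0, rfl⟩⟩

/-- Embedding a middle term: with `N₁ ⊆ P₁` and `N₂ ⊆ P₂`, the inclusion of `N₁` extends to the
extension `N` of `N₂` by `N₁`, and `N ⊆ P₁ × P₂` with cokernel an extension of the cokernels. -/
lemma _root_.HasCosyzygy.horseshoe {N₁ N₂ W₁ W₂ : Type u} [AddCommGroup N₁] [Module R N₁]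
    [AddCommGroup N₂] [Module R N₂] [AddCommGroup W₁] [Module R W₁] [AddCommGroup W₂] [Module R W₂]
    {a : N₁ →ₗ[R] N} {b : N →ₗ[R] N₂} (ha : Function.Injective a) (hab : Function.Exact a b)
    (hb : Function.Surjective b) (hN₂ : ProjOrth R N₂) (h₁ : HasCosyzygy R N₁ W₁)
    (h₂ : HasCosyzygy R N₂ W₂) :
    ∃ (W : ModuleCat.{u} R) (α : W₁ →ₗ[R] W) (β : W →ₗ[R] W₂), Function.Injective α ∧
      Function.Exact α β ∧ Function.Surjective β ∧ HasCosyzygy R N W := by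
  obtain ⟨P₁, _, _, _, f₁, g₁, hf₁, hfg₁, hg₁⟩ := h₁
  obtain ⟨P₂, _, _, _, f₂, g₂, hf₂, hfg₂, hg₂⟩ := h₂
  obtain ⟨t, ht⟩ := hN₂.exists_extension ha hab hb f₁
  have ht' : ∀ x, t (a x) = f₁ x := LinearMap.congr_fun ht
  let f : N →ₗ[R] P₁ × P₂ := t.prod (f₂ ∘ₗ b)
  have hfa : ∀ x, f (a x) = (f₁ x, 0) := fun x => by
    simp [f, ht', hab.apply_apply_eq_zero]
  -- the two maps between the cokernels
  let α' : P₁ →ₗ[R] (P₁ × P₂) ⧸ LinearMap.range f :=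
    (LinearMap.range f).mkQ ∘ₗ LinearMap.inl R P₁ P₂
  have hα' : ∀ p, α' p = 0 ↔ g₁ p = 0 := fun p => by
    simp only [α', LinearMap.comp_apply, Submodule.mkQ_apply, Submodule.Quotient.mk_eq_zero,
      LinearMap.inl_apply, LinearMap.mem_range, hfg₁ p, Set.mem_range]
    constructor
    · rintro ⟨n, hn⟩
      have h2 : f₂ (b n) = 0 := congrArg Prod.snd hn
      obtain ⟨x, rfl⟩ := (hab n).1 (hf₂ (h2.trans (map_zero f₂).symm))
      exact ⟨x, by rw [← ht']; exact congrArg Prod.fst hn⟩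
    · rintro ⟨x, rfl⟩
      exact ⟨a x, hfa x⟩
  obtain ⟨α, hα⟩ := exists_factor_of_surjective hg₁ α' fun p hp => (hα' p).2 hp
  let β : (P₁ × P₂) ⧸ LinearMap.range f →ₗ[R] W₂ :=
    (LinearMap.range f).liftQ (g₂ ∘ₗ LinearMap.snd R P₁ P₂) (by
      rintro _ ⟨n, rfl⟩
      simp [f, hfg₂.apply_apply_eq_zero])
  refine ⟨ModuleCat.of R ((P₁ × P₂) ⧸ LinearMap.range f), α, β, ?_, ?_, ?_, P₁ × P₂,
    inferInstance, inferInstance, inferInstance, f, (LinearMap.range f).mkQ, ?_,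
    LinearMap.exact_map_mkQ_range f, Submodule.mkQ_surjective _⟩
  · refine (injective_iff_map_eq_zero α).2 fun w hw => ?_
    obtain ⟨p, rfl⟩ := hg₁ w
    rwa [hα, hα'] at hw
  · intro w
    obtain ⟨⟨p₁, p₂⟩, rfl⟩ := Submodule.mkQ_surjective _ w
    constructor
    · intro hw
      obtain ⟨x, hx⟩ := (hfg₂ p₂).1 hw
      obtain ⟨n, rfl⟩ := hb x
      refine ⟨g₁ (p₁ - t n), ?_⟩
      rw [hα, ← sub_eq_zero]
      refine (Submodule.Quotient.mk_eq_zero _).2 ⟨-n, ?_⟩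
      ext <;> simp [f, hx]
    · rintro ⟨w₁, hw₁⟩
      obtain ⟨p, rfl⟩ := hg₁ w₁
      rw [← hw₁, hα]
      change g₂ 0 = 0
      exact map_zero _
  · intro w
    obtain ⟨p, rfl⟩ := hg₂ w
    exact ⟨Submodule.Quotient.mk (0, p), rfl⟩
  · refine (injective_iff_map_eq_zero f).2 fun n hn => ?_
    have h2 : f₂ (b n) = 0 := congrArg Prod.snd hn
    obtain ⟨x, rfl⟩ := (hab n).1 (hf₂ (h2.trans (map_zero f₂).symm))
    have h1 : t (a x) = 0 := congrArg Prod.fst hn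
    rw [hf₁ ((ht' x).symm.trans (h1.trans (map_zero f₁).symm)), map_zero]

/-- Gorenstein projective modules are closed under extensions. -/
theorem of_extension {a : G₁ →ₗ[R] N} {b : N →ₗ[R] G₂} (ha : Function.Injective a)
    (hab : Function.Exact a b) (hb : Function.Surjective b) (h₁ : IsGorensteinProjective R G₁)
    (h₂ : IsGorensteinProjective R G₂) : IsGorensteinProjective R N := by
  refine isGorensteinProjective_of_coinduction
    (fun N => ∃ (G₁ G₂ : ModuleCat.{u} R) (a : G₁ →ₗ[R] N) (b : N →ₗ[R] G₂),
      Function.Injective a ∧ Function.Exact a b ∧ Function.Surjective b ∧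
      IsGorensteinProjective R G₁ ∧ IsGorensteinProjective R G₂) ?_ N
    ⟨ModuleCat.of R G₁, ModuleCat.of R G₂, a, b, ha, hab, hb, h₁, h₂⟩
  rintro N ⟨G₁, G₂, a, b, ha, hab, hb, h₁, h₂⟩
  obtain ⟨W₁, hW₁, hG₁⟩ := h₁.exists_cosyzygy
  obtain ⟨W₂, hW₂, hG₂⟩ := h₂.exists_cosyzygy
  obtain ⟨W, α, β, hα, hαβ, hβ, hW⟩ := HasCosyzygy.horseshoe ha hab hb h₂.projOrth hG₁ hG₂
  exact ⟨ProjOrth.middle ha hab hb h₁.projOrth h₂.projOrth, W,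
    ⟨W₁, W₂, α, β, hα, hαβ, hβ, hW₁, hW₂⟩, hW⟩

lemma prod (h₁ : IsGorensteinProjective R G₁) (h₂ : IsGorensteinProjective R G₂) :
    IsGorensteinProjective R (G₁ × G₂) :=
  of_extension LinearMap.inl_injective Function.Exact.inl_snd LinearMap.snd_surjective h₁ h₂

/-- Only the vanishing of `Ext` and one cosyzygy in the class have to be checked. -/
lemma of_cosyzygy {W : Type u} [AddCommGroup W] [Module R W] (hN : ProjOrth R N)
    (h : HasCosyzygy R N W) (hW : IsGorensteinProjective R W) : IsGorensteinProjective R N := by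
  refine isGorensteinProjective_of_coinduction
    (fun N => IsGorensteinProjective R N ∨ ProjOrth R N ∧ ∃ W : ModuleCat.{u} R,
      IsGorensteinProjective R W ∧ HasCosyzygy R N W) ?_ N
    (Or.inr ⟨hN, ModuleCat.of R W, hW, h⟩)
  rintro N (hN | ⟨hN, W, hW, h⟩)
  · obtain ⟨W, hW, h⟩ := hN.exists_cosyzygy
    exact ⟨hN.projOrth, W, Or.inl hW, h⟩
  · exact ⟨hN, W, Or.inl hW, h⟩

/-- The kernel of a surjection between Gorenstein projective modules is Gorenstein projective:
embed the source `G₁` into a projective `P`; then `P / N` is an extension of `P / G₁` by `G₂`. -/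
theorem of_ker {a : N →ₗ[R] G₁} {b : G₁ →ₗ[R] G₂} (ha : Function.Injective a)
    (hab : Function.Exact a b) (hb : Function.Surjective b) (h₁ : IsGorensteinProjective R G₁)
    (h₂ : IsGorensteinProjective R G₂) : IsGorensteinProjective R N := by
  obtain ⟨W, hW, P, _, _, _, f, g, hf, hfg, hg⟩ := h₁.exists_cosyzygy
  obtain ⟨α, hα⟩ := exists_factor_of_surjective hb ((LinearMap.range (f ∘ₗ a)).mkQ ∘ₗ f)
    (fun x hx => by
      obtain ⟨n, rfl⟩ := (hab x).1 hx
      exact (Submodule.Quotient.mk_eq_zero _).2 ⟨n, rfl⟩)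
  let β : P ⧸ LinearMap.range (f ∘ₗ a) →ₗ[R] W := (LinearMap.range (f ∘ₗ a)).liftQ g (by
    rintro _ ⟨n, rfl⟩
    exact hfg.apply_apply_eq_zero _)
  have hQ : IsGorensteinProjective R (P ⧸ LinearMap.range (f ∘ₗ a)) := by
    refine of_extension (a := α) (b := β) ?_ ?_ ?_ h₂ hW
    · refine (injective_iff_map_eq_zero α).2 fun y hy => ?_
      obtain ⟨x, rfl⟩ := hb y
      rw [hα] at hy
      obtain ⟨n, hn⟩ := (Submodule.Quotient.mk_eq_zero _).1 hy
      rw [← hf hn, hab.apply_apply_eq_zero]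
    · intro w
      obtain ⟨p, rfl⟩ := Submodule.mkQ_surjective _ w
      constructor
      · intro hp
        obtain ⟨x, rfl⟩ := (hfg p).1 hp
        exact ⟨b x, hα x⟩
      · rintro ⟨y, hy⟩
        obtain ⟨x, rfl⟩ := hb y
        rw [← hy, hα]
        exact hfg.apply_apply_eq_zero _
    · intro w
      obtain ⟨p, rfl⟩ := hg w
      exact ⟨Submodule.Quotient.mk p, rfl⟩
  exact of_cosyzygy (ProjOrth.left ha hab hb h₁.projOrth h₂.projOrth)
    ⟨P, _, _, ‹_›, f ∘ₗ a, (LinearMap.range (f ∘ₗ a)).mkQ, hf.comp ha,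
      LinearMap.exact_map_mkQ_range _, Submodule.mkQ_surjective _⟩ hQ

end IsGorensteinProjective

end GorensteinProjective

/-! ### Syzygies of modules of finite Gorenstein projective dimension -/

section Resolution

variable {R : Type u} [CommRing R]

namespace HasGorensteinProjectiveResolution

variable {n : ℕ} {N N' G K : Type u} [AddCommGroup N] [Module R N] [AddCommGroup N'] [Module R N']
  [AddCommGroup G] [Module R G] [AddCommGroup K] [Module R K]

lemma of_equiv (e : N ≃ₗ[R] N') (h : HasGorensteinProjectiveResolution R n N) :
    HasGorensteinProjectiveResolution R n N' := by
  cases h with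
  | zero _ h => exact .zero _ (h.of_equiv e)
  | succ n K G _ f g hf hfg hg hG hK =>
    refine .succ n K G N' f (e.toLinearMap ∘ₗ g) hf (fun x => ?_) (e.surjective.comp hg) hG hK
    simp [hfg x]

/-- The kernel of a surjection onto a Gorenstein projective module has a resolution of the same
length as the source. -/
lemma of_ker {a : K →ₗ[R] N} {b : N →ₗ[R] G} (ha : Function.Injective a)
    (hab : Function.Exact a b) (hb : Function.Surjective b) (hG : IsGorensteinProjective R G)
    (h : HasGorensteinProjectiveResolution R n N) :
    HasGorensteinProjectiveResolution R n K := by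
  cases h with
  | zero _ h => exact .zero _ (h.of_ker ha hab hb hG)
  | succ n K₁ G₁ _ f g hf hfg hg hG₁ hK₁ =>
    have hG' : IsGorensteinProjective R (LinearMap.ker (b ∘ₗ g)) :=
      IsGorensteinProjective.of_ker Subtype.val_injective (LinearMap.exact_subtype_ker_map _)
        (hb.comp hg) hG₁ hG
    let e : K ≃ₗ[R] LinearMap.ker b :=
      (LinearEquiv.ofInjective a ha).trans (LinearEquiv.ofEq _ _ hab.linearMap_ker_eq.symm)
    refine of_equiv e.symm (.succ n K₁ (LinearMap.ker (b ∘ₗ g)) (LinearMap.ker b)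
      (f.codRestrict _ fun x => by simp [hfg.apply_apply_eq_zero])
      (g.restrict (p := LinearMap.ker (b ∘ₗ g)) (q := LinearMap.ker b) fun x hx => hx)
      (fun x y hxy => hf (congrArg Subtype.val hxy)) ?_ ?_ hG' hK₁)
    · rintro ⟨x, hx⟩
      rw [← Subtype.coe_inj]
      change g x = 0 ↔ _
      rw [hfg x]
      simp [Subtype.ext_iff]
    · rintro ⟨y, hy⟩
      obtain ⟨x, rfl⟩ := hg y
      exact ⟨⟨x, hy⟩, rfl⟩

lemma prod_projective (P : Type u) [AddCommGroup P] [Module R P] [Module.Projective R P]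
    (h : HasGorensteinProjectiveResolution R n N) :
    HasGorensteinProjectiveResolution R n (N × P) := by
  have hP := IsGorensteinProjective.of_projective (R := R) P
  cases h with
  | zero _ h => exact .zero _ (h.prod hP)
  | succ n K G _ f g hf hfg hg hG hK =>
    refine .succ n K (G × P) (N × P) (LinearMap.inl R G P ∘ₗ f) (g.prodMap LinearMap.id)
      (LinearMap.inl_injective.comp hf) ?_ (hg.prodMap Function.surjective_id) (hG.prod hP) hK
    rintro ⟨x, p⟩
    have := hfg x
    simp only [LinearMap.prodMap_apply, Prod.mk_eq_zero, this, Set.mem_range, LinearMap.id_apply,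
      LinearMap.comp_apply, LinearMap.inl_apply, Prod.mk.injEq]
    exact ⟨fun ⟨⟨y, hy⟩, hp⟩ => ⟨y, hy, hp.symm⟩, fun ⟨y, hy, hp⟩ => ⟨⟨y, hy⟩, hp.symm⟩⟩

/-- Passing to a syzygy shortens a resolution by one step. Given `0 → K → G → N → 0` and
`0 → N' → P → N → 0` with `P` projective, a lift `P → G` gives `0 → N' → K × P → G → 0`. -/
theorem syzygy {P : Type u} [AddCommGroup P] [Module R P] [Module.Projective R P]
    {i : N' →ₗ[R] P} {p : P →ₗ[R] N} (hi : Function.Injective i) (hip : Function.Exact i p)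
    (hp : Function.Surjective p) (h : HasGorensteinProjectiveResolution R (n + 1) N) :
    HasGorensteinProjectiveResolution R n N' := by
  cases h with
  | succ n K G _ f g hf hfg hg hG hK =>
    obtain ⟨l, hl⟩ := Module.projective_lifting_property g p hg
    have hl' : ∀ x, g (l x) = p x := LinearMap.congr_fun hl
    let b : K × P →ₗ[R] G := f.coprod l
    have hb : Function.Surjective b := fun x => by
      obtain ⟨y, hy⟩ := hp (g x)
      obtain ⟨k, hk⟩ := (hfg (x - l y)).1 (by rw [map_sub, hl', hy, sub_self])
      exact ⟨(k, y), by simp [b, hk]⟩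
    let e : LinearMap.ker b →ₗ[R] P := LinearMap.snd R K P ∘ₗ (LinearMap.ker b).subtype
    have he : Function.Injective e := by
      refine (injective_iff_map_eq_zero e).2 ?_
      rintro ⟨⟨k, y⟩, hk⟩ (hy : y = 0)
      have : f k + l y = 0 := hk
      rw [hy, map_zero, add_zero] at this
      have hk0 := hf (this.trans (map_zero f).symm)
      exact Subtype.ext (Prod.ext hk0 hy)
    have her : LinearMap.range e = LinearMap.range i := by
      ext y
      rw [← hip.linearMap_ker_eq, LinearMap.mem_ker, ← hl', LinearMap.mem_range]
      constructor
      · rintro ⟨⟨⟨k, y'⟩, hk⟩, rfl⟩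
        have : f k + l y' = 0 := hk
        change g (l y') = 0
        rw [eq_neg_of_add_eq_zero_right this, map_neg, hfg.apply_apply_eq_zero, neg_zero]
      · intro hy
        obtain ⟨k, hk⟩ := (hfg _).1 hy
        exact ⟨⟨(-k, y), by simp [b, hk]⟩, rfl⟩
    have hker : HasGorensteinProjectiveResolution R n (LinearMap.ker b) :=
      of_ker Subtype.val_injective (LinearMap.exact_subtype_ker_map b) hb hG
        (hK.prod_projective P)
    exact hker.of_equiv (((LinearEquiv.ofInjective e he).trans (LinearEquiv.ofEq _ _ her)).trans
      (LinearEquiv.ofInjective i hi).symm)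

end HasGorensteinProjectiveResolution

/-- The dual of Schanuel's lemma: given `0 → G → K → W → 0` and `0 → G → P → M → 0`, an extension
`K → P` of `G → P` gives a short exact sequence `0 → K → W × P → M → 0`. -/
lemma exists_exact_of_extension {G K W P M : Type u} [AddCommGroup G] [Module R G]
    [AddCommGroup K] [Module R K] [AddCommGroup W] [Module R W] [AddCommGroup P] [Module R P]
    [AddCommGroup M] [Module R M] {f : G →ₗ[R] K} {g : K →ₗ[R] W} {i : G →ₗ[R] P} {p : P →ₗ[R] M}
    (hfg : Function.Exact f g) (hg : Function.Surjective g)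
    (hi : Function.Injective i) (hip : Function.Exact i p) (hp : Function.Surjective p)
    (t : K →ₗ[R] P) (ht : t ∘ₗ f = i) :
    ∃ (a : K →ₗ[R] W × P) (b : W × P →ₗ[R] M),
      Function.Injective a ∧ Function.Exact a b ∧ Function.Surjective b := by
  have ht' : ∀ x, t (f x) = i x := LinearMap.congr_fun ht
  obtain ⟨w, hw'⟩ := exists_factor_of_surjective hg (p ∘ₗ t) (fun x hx => by
    obtain ⟨n, rfl⟩ := (hfg x).1 hx
    simp [ht', hip.apply_apply_eq_zero])
  have hw : ∀ x, w (g x) = p (t x) := hw'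
  refine ⟨g.prod (-t), w.coprod p, ?_, ?_, ?_⟩
  · refine (injective_iff_map_eq_zero _).2 fun x hx => ?_
    obtain ⟨y, rfl⟩ := (hfg x).1 (congrArg Prod.fst hx)
    have h2 : -t (f y) = 0 := congrArg Prod.snd hx
    rw [neg_eq_zero, ht'] at h2
    rw [hi (h2.trans (map_zero i).symm), map_zero]
  · rintro ⟨y, q⟩
    constructor
    · intro hy
      obtain ⟨x, rfl⟩ := hg y
      replace hy : w (g x) + p q = 0 := hy
      rw [hw, ← map_add] at hy
      obtain ⟨z, hz⟩ := (hip _).1 hy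
      refine ⟨x - f z, ?_⟩
      ext
      · simp [hfg.apply_apply_eq_zero]
      · simp [ht', hz]
    · rintro ⟨x, hx⟩
      rw [← hx]
      simp [hw]
  · intro m
    obtain ⟨q, rfl⟩ := hp m
    exact ⟨(0, q), by simp⟩

namespace IsGorensteinProjective

/-- Let `G` be Gorenstein projective. An embedding of `G` into a projective module `K` along which
all maps to projective modules extend has a Gorenstein projective cokernel. -/
lemma cokernel {G K W : Type u} [AddCommGroup G] [Module R G]
    [AddCommGroup K] [Module R K] [Module.Projective R K] [AddCommGroup W] [Module R W]
    {f : G →ₗ[R] K} {g : K →ₗ[R] W} (hfg : Function.Exact f g)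
    (hg : Function.Surjective g) (hG : IsGorensteinProjective R G)
    (h : ∀ (Q : Type u) [AddCommGroup Q] [Module R Q] [Module.Projective R Q] (h : G →ₗ[R] Q),
      ∃ h' : K →ₗ[R] Q, h' ∘ₗ f = h) : IsGorensteinProjective R W := by
  obtain ⟨W₀, hW₀, P, _, _, _, i, p, hi, hip, hp⟩ := hG.exists_cosyzygy
  obtain ⟨t, ht⟩ := h P i
  obtain ⟨a, b, ha, hab, hb⟩ := exists_exact_of_extension hfg hg hi hip hp t ht
  exact of_ker LinearMap.inl_injective Function.Exact.inl_snd LinearMap.snd_surjective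
    (of_extension ha hab hb (of_projective K) hW₀) (of_projective P)

/-- A finitely generated Gorenstein projective module embeds into a finite free module with
Gorenstein projective cokernel: embed it into some free module, and keep the coordinates in which
the generators do not vanish. -/
theorem exists_finite_free_embedding {G : Type u} [AddCommGroup G] [Module R G]
    [Module.Finite R G] (hG : IsGorensteinProjective R G) :
    ∃ (n : ℕ) (f : G →ₗ[R] (Fin n → R)), Function.Injective f ∧
      IsGorensteinProjective R ((Fin n → R) ⧸ LinearMap.range f) := by
  classical
  obtain ⟨W₀, hW₀, P, _, _, _, i, p, hi, hip, hp⟩ := hG.exists_cosyzygy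
  obtain ⟨s, hs⟩ := (Module.projective_def (R := R) (P := P)).1 inferInstance
  let r : (P →₀ R) →ₗ[R] P := Finsupp.linearCombination R id
  have hrs : ∀ x, r (s x) = x := hs
  obtain ⟨T, hT⟩ := Module.finite_def.1 (inferInstance : Module.Finite R G)
  -- the coordinates in which `G` does not vanish
  let S : Finset P := T.biUnion fun x => (s (i x)).support
  have hS : ∀ x : G, s (i x) ∈ Finsupp.supported R R (S : Set P) := fun x => by
    have hx : x ∈ Submodule.span R (T : Set G) := hT ▸ Submodule.mem_top
    refine (Submodule.span_le (p := (Finsupp.supported R R (S : Set P)).comap (s ∘ₗ i))).2 ?_ hx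
    intro y hy
    refine (Finsupp.mem_supported R _).2 fun z hz => ?_
    exact Finset.mem_coe.2 (Finset.mem_biUnion.2 ⟨y, hy, hz⟩)
  let e : Finsupp.supported R R (S : Set P) ≃ₗ[R] (Fin S.card → R) :=
    ((Finsupp.supportedEquivFinsupp (S : Set P)).trans
      (Finsupp.domLCongr S.equivFin)).trans (Finsupp.linearEquivFunOnFinite R R (Fin S.card))
  let f : G →ₗ[R] (Fin S.card → R) := e.toLinearMap ∘ₗ (s ∘ₗ i).codRestrict _ hS
  have hsymm : ∀ x, ((e.symm (f x) : Finsupp.supported R R (S : Set P)) : P →₀ R) = s (i x) :=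
    fun x => by simp [f]
  refine ⟨S.card, f, fun x y hxy => ?_, ?_⟩
  · refine hi ?_
    rw [← hrs (i x), ← hrs (i y), ← hsymm, ← hsymm, hxy]
  · refine hG.cokernel (LinearMap.exact_map_mkQ_range f) (Submodule.mkQ_surjective _) ?_
    intro Q _ _ _ h
    obtain ⟨h', hh'⟩ := hW₀.projOrth.exists_extension hi hip hp h
    refine ⟨h' ∘ₗ r ∘ₗ (Finsupp.supported R R (S : Set P)).subtype ∘ₗ e.symm.toLinearMap,
      LinearMap.ext fun x => ?_⟩
    simp only [LinearMap.comp_apply, LinearEquiv.coe_coe, Submodule.subtype_apply, hsymm, hrs]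
    exact LinearMap.congr_fun hh' x

end IsGorensteinProjective

/-- Over a noetherian ring, a finitely generated module `M` with a Gorenstein projective resolution
of length one has one of the form `0 → R^n → H → M → 0` with `H` finitely generated. -/
theorem HasGorensteinProjectiveResolution.exists_free_kernel [IsNoetherianRing R] {M : Type u}
    [AddCommGroup M] [Module R M] [Module.Finite R M]
    (h : HasGorensteinProjectiveResolution R 1 M) :
    ∃ (n : ℕ) (H : Type u) (_ : AddCommGroup H) (_ : Module R H) (_ : Module.Finite R H)
      (a : (Fin n → R) →ₗ[R] H) (b : H →ₗ[R] M), IsGorensteinProjective R H ∧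
      Function.Injective a ∧ Function.Exact a b ∧ Function.Surjective b := by
  obtain ⟨m, p, hp⟩ := Module.Finite.exists_fin' R M
  have hG : IsGorensteinProjective R (LinearMap.ker p) := by
    cases h.syzygy Subtype.val_injective (LinearMap.exact_subtype_ker_map p) hp with
    | zero _ h => exact h
  obtain ⟨n, f, hf, hW⟩ := hG.exists_finite_free_embedding
  obtain ⟨t, ht⟩ := hW.projOrth.exists_extension hf (LinearMap.exact_map_mkQ_range f)
    (Submodule.mkQ_surjective _) (LinearMap.ker p).subtype
  obtain ⟨a, b, ha, hab, hb⟩ := exists_exact_of_extension (LinearMap.exact_map_mkQ_range f)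
    (Submodule.mkQ_surjective _) Subtype.val_injective (LinearMap.exact_subtype_ker_map p) hp t ht
  exact ⟨n, ((Fin n → R) ⧸ LinearMap.range f) × (Fin m → R), inferInstance, inferInstance,
    inferInstance, a, b, hW.prod (IsGorensteinProjective.of_projective _), ha, hab, hb⟩

end Resolution

/-! ### The Auslander–Buchsbaum formula along an exact functor -/

section Depth

open Abelian Limits IsLocalRing

universe w w' v'

variable {R : Type u} [CommRing R] [IsLocalRing R] {D : Type w'} [Category.{v'} D] [Abelian D]
  [HasExt.{w} D] (F : ModuleCat.{u} R ⥤ D) (K : D)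

/-- `N` has depth `d` with respect to `Ext^*(K, F -)`, and the first non-vanishing group contains a
non-zero class annihilated by the maximal ideal. -/
structure HasSocleDepth (N : Type u) [AddCommGroup N] [Module R N] (d : ℕ) : Prop where
  subsingleton : ∀ j < d, Subsingleton (ExtAlong F K N j)
  exists_socle : ∃ w : ExtAlong F K N d, w ≠ 0 ∧
    ∀ r ∈ maximalIdeal R, ExtAlong.map F K d (r • LinearMap.id) w = 0

namespace HasSocleDepth

variable {F K} [F.Additive] {d : ℕ}

/-- A map of finite free modules that is injective on `Ext^d(K, F -)` is split injective. A vector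
`v` that is non-zero modulo the maximal ideal while `φ v` is zero modulo it would send a socle
class `w` to a non-zero class `v • w` in the kernel. -/
theorem exists_leftInverse (hd : HasSocleDepth F K R d) {a b : ℕ}
    (φ : (Fin a → R) →ₗ[R] (Fin b → R)) (hφ : Function.Injective (ExtAlong.map F K d φ)) :
    ∃ ψ : (Fin b → R) →ₗ[R] (Fin a → R), ψ ∘ₗ φ = LinearMap.id := by
  obtain ⟨w, hw, hsoc⟩ := hd.exists_socle
  rw [IsLocalRing.split_injective_iff_lTensor_residueField_injective]
  have hker : ∀ {n : ℕ} (v : Fin n → R),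
      TensorProduct.mk R (ResidueField R) (Fin n → R) 1 v = 0 ↔ ∀ i, v i ∈ maximalIdeal R := by
    intro n v
    have h1 : TensorProduct.mk R (ResidueField R) (Fin n → R) 1 v = 0 ↔
        v ∈ maximalIdeal R • (⊤ : Submodule R (Fin n → R)) := by
      rw [← LinearMap.mem_ker]
      exact iff_of_eq (congrArg (v ∈ ·)
        (LinearMap.ker_tensorProductMk (I := maximalIdeal R) (Fin n → R)))
    rw [h1]
    clear h1
    constructor
    · intro hv i
      induction hv using Submodule.smul_induction_on' with
      | smul r hr x _ => exact Ideal.mul_mem_right _ _ hr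
      | add x _ y _ hx hy => exact add_mem hx hy
    · intro hv
      rw [pi_eq_sum_univ v]
      exact sum_mem fun i _ => Submodule.smul_mem_smul (hv i) trivial
  refine (injective_iff_map_eq_zero _).2 fun z hz => ?_
  obtain ⟨v, rfl⟩ := TensorProduct.mk_surjective R (Fin a → R) (ResidueField R)
    residue_surjective z
  have hv : ∀ i, φ v i ∈ maximalIdeal R := (hker (φ v)).1 hz
  rw [hker]
  intro i
  by_contra hi
  have hi' : IsUnit (v i) := by simpa using hi
  have hproj : ∀ {n : ℕ} (u : Fin n → R) (i : Fin n),
      LinearMap.proj i ∘ₗ LinearMap.toSpanSingleton R (Fin n → R) u = u i • LinearMap.id :=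
    fun u i => LinearMap.ext fun r => by simp [mul_comm]
  have hx : ExtAlong.map F K d (LinearMap.toSpanSingleton R (Fin a → R) v) w = 0 := by
    refine hφ ?_
    rw [map_zero, ← ExtAlong.map_comp_apply]
    refine ExtAlong.eq_zero_of_forall_proj F K _ fun j => ?_
    rw [← ExtAlong.map_comp_apply, LinearMap.comp_toSpanSingleton, hproj]
    exact hsoc _ (hv j)
  refine ExtAlong.map_unit_smul_ne_zero F K d hi' hw ?_
  rw [← hproj, ExtAlong.map_comp_apply, hx, map_zero]

variable [PreservesFiniteLimits F] [PreservesFiniteColimits F]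

/-- Dimension shifting along embeddings into finite free modules, whose cokernels are again finitely
generated and Gorenstein projective. -/
lemma subsingleton_of_isGorensteinProjective (hd : HasSocleDepth F K R d) {G : Type u}
    [AddCommGroup G] [Module R G] [Module.Finite R G] (hG : IsGorensteinProjective R G) {j : ℕ}
    (hj : j < d) : Subsingleton (ExtAlong F K G j) := by
  induction j generalizing G with
  | zero =>
    obtain ⟨n, f, hf, hW⟩ := hG.exists_finite_free_embedding
    exact ExtAlong.subsingleton_left F K hf (LinearMap.exact_map_mkQ_range f)
      (Submodule.mkQ_surjective _) (fun i hi => by omega)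
      (ExtAlong.subsingleton_pi F K (hd.subsingleton 0 hj))
  | succ j ih =>
    obtain ⟨n, f, hf, hW⟩ := hG.exists_finite_free_embedding
    refine ExtAlong.subsingleton_left F K hf (LinearMap.exact_map_mkQ_range f)
      (Submodule.mkQ_surjective _) (fun i hi => ?_)
      (ExtAlong.subsingleton_pi F K (hd.subsingleton _ hj))
    obtain rfl : i = j := by omega
    exact ih hW (by omega)

/-- A finitely generated Gorenstein projective module embeds into a finite free module by a map that
is injective on `Ext^d(K, F -)`. -/
lemma exists_embedding (hd : HasSocleDepth F K R d) {G : Type u}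
    [AddCommGroup G] [Module R G] [Module.Finite R G] (hG : IsGorensteinProjective R G) :
    ∃ (n : ℕ) (f : G →ₗ[R] (Fin n → R)), Function.Injective f ∧
      Function.Injective (ExtAlong.map F K d f) ∧
      IsGorensteinProjective R ((Fin n → R) ⧸ LinearMap.range f) := by
  obtain ⟨n, f, hf, hW⟩ := hG.exists_finite_free_embedding
  exact ⟨n, f, hf, ExtAlong.map_injective F K hf (LinearMap.exact_map_mkQ_range f)
    (Submodule.mkQ_surjective _) fun i hi =>
      hd.subsingleton_of_isGorensteinProjective hW (by omega), hW⟩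

/-- Embed `G` into a finite free module `F₀` and `F₀ / G` into a finite free module `F₁`. If
`Ext^d(K, F G)` vanished, then `F₀ → F₁` would be injective on `Ext^d(K, F -)`, hence injective, but
`G` is its kernel. -/
lemma nontrivial_of_isGorensteinProjective (hd : HasSocleDepth F K R d) {G : Type u}
    [AddCommGroup G] [Module R G] [Module.Finite R G] [Nontrivial G]
    (hG : IsGorensteinProjective R G) : Nontrivial (ExtAlong F K G d) := by
  by_contra hT
  rw [not_nontrivial_iff_subsingleton] at hT
  obtain ⟨a, f, hf, -, hW⟩ := hd.exists_embedding hG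
  obtain ⟨b, f', hf', hf'T, -⟩ := hd.exists_embedding hW
  have hinj : Function.Injective
      (ExtAlong.map F K d (f' ∘ₗ (LinearMap.range f).mkQ)) := by
    refine (injective_iff_map_eq_zero _).2 fun x hx => ?_
    rw [ExtAlong.map_comp_apply] at hx
    obtain ⟨y, rfl⟩ := ExtAlong.exists_map_eq F K hf (LinearMap.exact_map_mkQ_range f)
      (Submodule.mkQ_surjective _) x (hf'T (hx.trans (map_zero _).symm))
    rw [hT.elim y 0, map_zero]
  obtain ⟨ψ, hψ⟩ := hd.exists_leftInverse _ hinj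
  obtain ⟨x, hx⟩ := exists_ne (0 : G)
  refine hx (hf ?_)
  have h0 : (LinearMap.range f).mkQ (f x) = 0 :=
    (Submodule.Quotient.mk_eq_zero _).2 ⟨x, rfl⟩
  have := LinearMap.congr_fun hψ (f x)
  simp only [LinearMap.comp_apply, h0, map_zero, LinearMap.id_apply] at this
  rw [← this, map_zero]

/-- The case of Gorenstein projective dimension one. In `0 → R^n → H → M → 0` with `H` Gorenstein
projective, if `Ext^(d-1)(K, F M)` vanished, then `R^n → H` would split. -/
lemma nontrivial_of_dim_one [IsNoetherianRing R] (hd : HasSocleDepth F K R d) {M : Type u}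
    [AddCommGroup M] [Module R M] [Module.Finite R M]
    (h : HasGorensteinProjectiveResolution R 1 M) (hM : ¬ IsGorensteinProjective R M) :
    ∃ t, t + 1 = d ∧ Nontrivial (ExtAlong F K M t) ∧
      ∀ j < t, Subsingleton (ExtAlong F K M j) := by
  obtain ⟨n, H, _, _, _, a, b, hH, ha, hab, hb⟩ := h.exists_free_kernel
  obtain ⟨m, f, hf, hfT, -⟩ := hd.exists_embedding hH
  have hlow : ∀ j, j + 1 < d → Subsingleton (ExtAlong F K M j) := fun j hj =>
    ExtAlong.subsingleton_right F K ha hab hb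
      (hd.subsingleton_of_isGorensteinProjective hH (by omega))
      (ExtAlong.subsingleton_pi F K (hd.subsingleton _ hj))
  by_contra hcon
  refine hM ?_
  have hinj : Function.Injective (ExtAlong.map F K d a) :=
    ExtAlong.map_injective F K ha hab hb fun i hi => by
      by_contra hi'
      exact hcon ⟨i, hi, not_subsingleton_iff_nontrivial.1 hi', fun j hj => hlow j (by omega)⟩
  obtain ⟨ψ, hψ⟩ := hd.exists_leftInverse (f ∘ₗ a) (by
    intro x y hxy
    rw [ExtAlong.map_comp_apply, ExtAlong.map_comp_apply] at hxy
    exact hinj (hfT hxy))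
  -- `ψ ∘ f` is a retraction of `a`, and its kernel is isomorphic to `M`
  have hr : ∀ x, ψ (f (a x)) = x := LinearMap.congr_fun hψ
  let e : LinearMap.ker (ψ ∘ₗ f) ≃ₗ[R] M :=
    LinearEquiv.ofBijective (b ∘ₗ (LinearMap.ker (ψ ∘ₗ f)).subtype) ⟨by
      refine (injective_iff_map_eq_zero _).2 ?_
      rintro ⟨x, hx⟩ hbx
      obtain ⟨y, rfl⟩ := (hab x).1 hbx
      have : y = 0 := (hr y).symm.trans hx
      simp [this], fun m => by
      obtain ⟨x, rfl⟩ := hb m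
      refine ⟨⟨x - a (ψ (f x)), ?_⟩, ?_⟩
      · simp [hr]
      · simp [hab.apply_apply_eq_zero]⟩
  exact (IsGorensteinProjective.of_ker Subtype.val_injective (LinearMap.exact_subtype_ker_map _)
    (fun x => ⟨a x, hr x⟩) hH (IsGorensteinProjective.of_projective (Fin n → R))).of_equiv e

/-- The Auslander–Buchsbaum formula: if the shortest Gorenstein projective resolution of `M` has
length `n`, then `n ≤ d` and `M` has depth `d - n`. -/
theorem auslander_buchsbaum [IsNoetherianRing R] (hd : HasSocleDepth F K R d) (n : ℕ) {M : Type u}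
    [AddCommGroup M] [Module R M] [Module.Finite R M] [Nontrivial M]
    (h : HasGorensteinProjectiveResolution R n M)
    (hmin : ∀ m < n, ¬ HasGorensteinProjectiveResolution R m M) :
    ∃ t, t + n = d ∧ Nontrivial (ExtAlong F K M t) ∧
      ∀ j < t, Subsingleton (ExtAlong F K M j) := by
  induction n generalizing M with
  | zero =>
    cases h with
    | zero _ h =>
      exact ⟨d, rfl, hd.nontrivial_of_isGorensteinProjective h, fun j hj =>
        hd.subsingleton_of_isGorensteinProjective h hj⟩
  | succ n ih =>
    cases n with
    | zero => exact hd.nontrivial_of_dim_one h fun h' => hmin 0 (by omega) (.zero _ h')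
    | succ n =>
      obtain ⟨m, p, hp⟩ := Module.Finite.exists_fin' R M
      have hF := IsGorensteinProjective.of_projective (R := R) (Fin m → R)
      have hex := LinearMap.exact_subtype_ker_map p
      have hsub := h.syzygy Subtype.val_injective hex hp
      have hmin' : ∀ l < n + 1, ¬ HasGorensteinProjectiveResolution R l (LinearMap.ker p) :=
        fun l hl hres => hmin (l + 1) (by omega)
          (.succ l _ _ M _ p Subtype.val_injective hex hp hF hres)
      have : Nontrivial (LinearMap.ker p) := by
        by_contra hT
        rw [not_nontrivial_iff_subsingleton, Submodule.subsingleton_iff_eq_bot] at hT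
        exact hmin 0 (by omega) (.zero _ (hF.of_equiv
          (LinearEquiv.ofBijective p ⟨LinearMap.ker_eq_bot.1 hT, hp⟩)))
      obtain ⟨t, ht, hnt, hlow⟩ := ih hsub hmin'
      have hFlow : ∀ j < d, Subsingleton (ExtAlong F K (Fin m → R) j) := fun j hj =>
        ExtAlong.subsingleton_pi F K (hd.subsingleton j hj)
      cases t with
      | zero =>
        exact absurd (ExtAlong.subsingleton_left F K Subtype.val_injective hex hp
          (fun i hi => by omega) (hFlow 0 (by omega))) (not_subsingleton_iff_nontrivial.2 hnt)
      | succ t =>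
        refine ⟨t, by omega, ?_, fun j hj => ExtAlong.subsingleton_right F K
          Subtype.val_injective hex hp (hFlow j (by omega)) (hlow (j + 1) (by omega))⟩
        by_contra hT
        rw [not_nontrivial_iff_subsingleton] at hT
        refine absurd (ExtAlong.subsingleton_left F K Subtype.val_injective hex hp
          (fun i hi => ?_) (hFlow (t + 1) (by omega))) (not_subsingleton_iff_nontrivial.2 hnt)
        obtain rfl : i = t := by omega
        exact hT

end HasSocleDepth

end Depth

/-! ### Depth over a noetherian local ring -/

section LocalDepth

open Abelian IsLocalRing Pointwise

variable {A : Type u} [CommRing A] [IsLocalRing A]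

variable (A) in
/-- The groups `Ext^j(k, N)` over the local ring `A` with residue field `k`. -/
abbrev ResidueExt (N : Type u) [AddCommGroup N] [Module A N] (j : ℕ) : Type u :=
  ExtAlong (𝟭 (ModuleCat.{u} A)) (ModuleCat.of A (ResidueField A)) N j

/-- The maximal ideal annihilates `Ext^j(k, X)`. -/
lemma residueExt_map_smul_eq_zero {X : Type u} [AddCommGroup X] [Module A X] {j : ℕ} {r : A}
    (hr : r ∈ maximalIdeal A)
    (x : ResidueExt A X j) :
    ExtAlong.map (𝟭 _) (ModuleCat.of A (ResidueField A)) j (r • LinearMap.id) x = 0 := by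
  have h0 : r • 𝟙 (ModuleCat.of A (ResidueField A)) = 0 := by
    ext y
    obtain ⟨y, rfl⟩ := residue_surjective y
    change residue A r * residue A y = 0
    rw [(residue_eq_zero_iff r).2 hr, zero_mul]
  have h1 : ExtAlong.map (𝟭 _) (ModuleCat.of A (ResidueField A)) j (r • LinearMap.id) x = r • x :=
    (Ext.smul_eq_comp_mk₀ x r).symm
  rw [h1]
  have h2 : r • x = (r • Ext.mk₀ (𝟙 (ModuleCat.of A (ResidueField A)))).comp x (zero_add j) := by
    rw [Ext.smul_comp, Ext.mk₀_id_comp]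
  rw [h2, ← Ext.mk₀_smul, h0, Ext.mk₀_zero, Ext.zero_comp]

/-- A nonzero finitely generated module over a noetherian local ring has finite depth: as long as
`Hom(k, X) = 0`, some element of the maximal ideal is regular on `X`, and passing to the quotient
by it can only be repeated finitely often. -/
theorem exists_nontrivial_residueExt [IsNoetherianRing A] (C : Type u) [AddCommGroup C] [Module A C]
    [Module.Finite A C] [Nontrivial C] :
    ∃ j, Nontrivial (ResidueExt A C j) := by
  suffices H : ∀ (U : Submodule A C) (X : Type u) [AddCommGroup X] [Module A X] [Nontrivial X]
      (f : C →ₗ[A] X), Function.Surjective f → LinearMap.ker f = U →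
      ∃ j, Nontrivial (ResidueExt A X j) from
    H _ C LinearMap.id Function.surjective_id rfl
  intro U
  induction U using WellFoundedGT.induction with
  | ind U ih =>
    intro X _ _ _ f hf hU
    by_contra! hT
    have hfin : Module.Finite A X := Module.Finite.of_surjective f hf
    have hhom : Subsingleton (ResidueField A →ₗ[A] X) := by
      have : Subsingleton (ModuleCat.of A (ResidueField A) ⟶ ModuleCat.of A X) :=
        Ext.homEquiv₀.subsingleton_congr.1 (hT 0)
      exact (ModuleCat.homAddEquiv (M := ModuleCat.of A (ResidueField A))
        (N := ModuleCat.of A X)).symm.subsingleton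
    obtain ⟨r, hr, hreg⟩ := IsSMulRegular.subsingleton_linearMap_iff.1 hhom
    have hrm : r ∈ maximalIdeal A := by
      have := Module.mem_annihilator.1 hr (1 : ResidueField A)
      rwa [Algebra.smul_def, mul_one, ResidueField.algebraMap_eq, residue_eq_zero_iff] at this
    have := nontrivial_quotSMulTop_of_mem_maximalIdeal X hrm
    have hlt : U < LinearMap.ker ((r • (⊤ : Submodule A X)).mkQ ∘ₗ f) := by
      subst hU
      refine lt_of_le_of_ne (LinearMap.ker_le_ker_comp _ _) fun heq => ?_
      obtain ⟨x, hx⟩ := exists_ne (0 : X)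
      obtain ⟨c, rfl⟩ := hf x
      have hmem : r • c ∈ LinearMap.ker ((r • (⊤ : Submodule A X)).mkQ ∘ₗ f) := by
        simp only [LinearMap.mem_ker, LinearMap.comp_apply, map_smul]
        rw [← map_smul, Submodule.mkQ_apply, Submodule.Quotient.mk_eq_zero]
        exact Submodule.smul_mem_pointwise_smul _ _ _ trivial
      rw [← heq, LinearMap.mem_ker, map_smul] at hmem
      exact hx (hreg (hmem.trans (smul_zero r).symm))
    obtain ⟨j, hj⟩ := ih _ hlt (QuotSMulTop r X) _
      ((Submodule.mkQ_surjective _).comp hf) rfl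
    exact not_subsingleton_iff_nontrivial.2 hj (ExtAlong.subsingleton_right (𝟭 _) _
      (f := LinearMap.lsmul A X r) hreg (LinearMap.exact_lsmul_mkQ_smul_top X r)
      (Submodule.mkQ_surjective _) (hT j) (hT (j + 1)))

/-- Every class in the first non-vanishing `Ext^e(k, C)` is annihilated by the maximal ideal. -/
theorem exists_hasSocleDepth [IsNoetherianRing A] (C : Type u) [AddCommGroup C] [Module A C]
    [Module.Finite A C] [Nontrivial C] :
    ∃ e, HasSocleDepth (𝟭 (ModuleCat.{u} A)) (ModuleCat.of A (ResidueField A)) C e := by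
  classical
  have hex := exists_nontrivial_residueExt (A := A) C
  refine ⟨Nat.find hex, fun j hj => not_nontrivial_iff_subsingleton.1 (Nat.find_min hex hj), ?_⟩
  obtain ⟨w, hw⟩ := @exists_ne _ (Nat.find_spec hex) 0
  exact ⟨w, hw, fun r hr => residueExt_map_smul_eq_zero hr w⟩

end LocalDepth

/-! ### Homomorphisms into a semi-dualizing module -/

section Hom

open Abelian IsLocalRing

variable {A : Type u} [CommRing A] {C : Type u} [AddCommGroup C] [Module A C]

lemma hom_shortExact {X Y Z : Type u} [AddCommGroup X] [Module A X] [AddCommGroup Y] [Module A Y]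
    [AddCommGroup Z] [Module A Z] {f : X →ₗ[A] Y} {g : Y →ₗ[A] Z} (hf : Function.Injective f)
    (hfg : Function.Exact f g) (hg : Function.Surjective g)
    (hZ : Subsingleton (Ext (ModuleCat.of A Z) (ModuleCat.of A C) 1)) :
    Function.Injective (LinearMap.lcomp A C g) ∧
    Function.Exact (LinearMap.lcomp A C g) (LinearMap.lcomp A C f) ∧
    Function.Surjective (LinearMap.lcomp A C f) := by
  refine ⟨fun h h' hh => (LinearMap.cancel_right hg).1 hh, ?_,
    fun h => exists_extension_of_ext hf hfg hg hZ h⟩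
  exact LinearMap.exact_lcomp_of_exact_of_surjective _ hfg hg

variable [IsLocalRing A]

/-- If `Ext^i(N, C) = 0` for all `i ≥ 1`, then `Hom(-, C)` turns a free resolution of `N` into a
coresolution of `Hom(N, C)` by finite powers of `C`. -/
lemma subsingleton_residueExt_hom [IsNoetherianRing A] {e j : ℕ}
    (hC : ∀ j < e, Subsingleton (ResidueExt A C j)) (hj : j < e) (N : Type u) [AddCommGroup N]
    [Module A N] [Module.Finite A N]
    (hN : ∀ i : ℕ, Subsingleton (Ext (ModuleCat.of A N) (ModuleCat.of A C) (i + 1))) :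
    Subsingleton (ResidueExt A (N →ₗ[A] C) j) := by
  induction j generalizing N with
  | zero =>
    obtain ⟨n, p, hp⟩ := Module.Finite.exists_fin' A N
    obtain ⟨h1, h2, h3⟩ := hom_shortExact (C := C) Subtype.val_injective
      (LinearMap.exact_subtype_ker_map p) hp (hN 0)
    exact ExtAlong.subsingleton_left _ _ h1 h2 h3 (fun i hi => by omega)
      (ExtAlong.subsingleton_of_equiv _ _ _ (Module.piEquiv (Fin n) A C)
        (ExtAlong.subsingleton_pi _ _ (hC 0 hj)))
  | succ j ih =>
    obtain ⟨n, p, hp⟩ := Module.Finite.exists_fin' A N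
    obtain ⟨h1, h2, h3⟩ := hom_shortExact (C := C) Subtype.val_injective
      (LinearMap.exact_subtype_ker_map p) hp (hN 0)
    refine ExtAlong.subsingleton_left _ _ h1 h2 h3 (fun i hi => ?_)
      (ExtAlong.subsingleton_of_equiv _ _ _ (Module.piEquiv (Fin n) A C)
        (ExtAlong.subsingleton_pi _ _ (hC _ hj)))
    obtain rfl : i = j := by omega
    exact ih (by omega) _ fun l => subsingleton_ext_left Subtype.val_injective
      (LinearMap.exact_subtype_ker_map p) hp (subsingleton_ext_of_projective _ _ l) (hN (l + 1))

/-- A nonzero map from `N` to the residue field, lifted to a functional on a free cover of `N`. -/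
lemma exists_functional [IsNoetherianRing A] {n : ℕ} {N : Type u} [AddCommGroup N] [Module A N]
    [Nontrivial N] {p : (Fin n → A) →ₗ[A] N} (hp : Function.Surjective p) :
    ∃ ε : (Fin n → A) →ₗ[A] A, (∃ x, IsUnit (ε x)) ∧ ∀ x, p x = 0 → ε x ∈ maximalIdeal A := by
  have : Module.Finite A N := Module.Finite.of_surjective p hp
  have : Nontrivial (TensorProduct A (ResidueField A) N) := by
    rw [← not_subsingleton_iff_nontrivial, IsLocalRing.subsingleton_tensorProduct]
    exact not_subsingleton N
  obtain ⟨g, hg⟩ := exists_ne (0 : Module.Dual (ResidueField A)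
    (TensorProduct A (ResidueField A) N))
  let θ : N →ₗ[A] ResidueField A :=
    g.restrictScalars A ∘ₗ TensorProduct.mk A (ResidueField A) N 1
  obtain ⟨ε, hε⟩ := Module.projective_lifting_property (Algebra.linearMap A (ResidueField A))
    (θ ∘ₗ p) residue_surjective
  have hε' : ∀ x, residue A (ε x) = θ (p x) := LinearMap.congr_fun hε
  refine ⟨ε, ?_, fun x hx => ?_⟩
  · by_contra! hcon
    refine hg (LinearMap.ext fun z => ?_)
    obtain ⟨y, rfl⟩ := TensorProduct.mk_surjective A N (ResidueField A) residue_surjective z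
    obtain ⟨x, rfl⟩ := hp y
    have := hε' x
    rw [(residue_eq_zero_iff _).2 (by simpa using hcon x)] at this
    exact this.symm
  · rw [← residue_eq_zero_iff, hε', hx, map_zero]

/-- If `Ext^i(N, C) = 0` for all `i ≥ 1` and `N ≠ 0`, then `Hom(N, C)` has the depth `e` of `C`. For
a presentation `F₁ → F₀ → N → 0`, the group `Ext^e(k, Hom(N, C))` is the kernel of
`Ext^e(k, Hom(F₀, C)) → Ext^e(k, Hom(F₁, C))`; a functional `ε` on `F₀` that factors through a
nonzero map `N → k` modulo the maximal ideal gives a nonzero class in it. -/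
lemma nontrivial_residueExt_hom [IsNoetherianRing A] {e : ℕ}
    (hC : HasSocleDepth (𝟭 (ModuleCat.{u} A)) (ModuleCat.of A (ResidueField A)) C e)
    (N : Type u) [AddCommGroup N] [Module A N] [Module.Finite A N] [Nontrivial N]
    (hN : ∀ i : ℕ, Subsingleton (Ext (ModuleCat.of A N) (ModuleCat.of A C) (i + 1))) :
    Nontrivial (ResidueExt A (N →ₗ[A] C) e) := by
  obtain ⟨w, hw, -⟩ := hC.exists_socle
  obtain ⟨n, p, hp⟩ := Module.Finite.exists_fin' A N
  obtain ⟨m, q, hq⟩ := Module.Finite.exists_fin' A (LinearMap.ker p)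
  obtain ⟨ε, ⟨x, hx⟩, hε⟩ := exists_functional hp
  have hN' : ∀ i : ℕ,
      Subsingleton (Ext (ModuleCat.of A (LinearMap.ker p)) (ModuleCat.of A C) (i + 1)) :=
    fun l => subsingleton_ext_left Subtype.val_injective (LinearMap.exact_subtype_ker_map p) hp
      (subsingleton_ext_of_projective _ _ l) (hN (l + 1))
  have hN'' : ∀ i : ℕ,
      Subsingleton (Ext (ModuleCat.of A (LinearMap.ker q)) (ModuleCat.of A C) (i + 1)) :=
    fun l => subsingleton_ext_left Subtype.val_injective (LinearMap.exact_subtype_ker_map q) hq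
      (subsingleton_ext_of_projective _ _ l) (hN' (l + 1))
  obtain ⟨h1, h2, h3⟩ := hom_shortExact (C := C) Subtype.val_injective
    (LinearMap.exact_subtype_ker_map p) hp (hN 0)
  obtain ⟨h1', h2', h3'⟩ := hom_shortExact (C := C) Subtype.val_injective
    (LinearMap.exact_subtype_ker_map q) hq (hN' 0)
  have hinj : Function.Injective (ExtAlong.map (𝟭 (ModuleCat.{u} A))
      (ModuleCat.of A (ResidueField A)) e (LinearMap.lcomp A C q)) :=
    ExtAlong.map_injective _ _ h1' h2' h3' fun i hi =>
      subsingleton_residueExt_hom hC.subsingleton (by omega) _ hN''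
  -- the map `c ↦ ε(-) c`
  let s : C →ₗ[A] ((Fin n → A) →ₗ[A] C) :=
    LinearMap.lcomp A C ε ∘ₗ (LinearMap.lsmul A C : A →ₗ[A] C →ₗ[A] C).flip
  have hs : ∀ y, LinearMap.applyₗ y ∘ₗ s = ε y • LinearMap.id := fun y => rfl
  have hsw : ExtAlong.map (𝟭 (ModuleCat.{u} A)) (ModuleCat.of A (ResidueField A)) e s w ≠ 0 := by
    intro h0
    refine ExtAlong.map_unit_smul_ne_zero _ _ e hx hw ?_
    rw [← hs, ExtAlong.map_comp_apply, h0, map_zero]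
  have hker : ExtAlong.map (𝟭 (ModuleCat.{u} A)) (ModuleCat.of A (ResidueField A)) e
      (LinearMap.lcomp A C (LinearMap.ker p).subtype) (ExtAlong.map _ _ e s w) = 0 := by
    refine hinj ?_
    rw [map_zero, ← ExtAlong.map_comp_apply, ← ExtAlong.map_comp_apply]
    set t := (LinearMap.lcomp A C q ∘ₗ LinearMap.lcomp A C (LinearMap.ker p).subtype) ∘ₗ s
    have ht : t = (Module.piEquiv (Fin m) A C).toLinearMap ∘ₗ
        (Module.piEquiv (Fin m) A C).symm.toLinearMap ∘ₗ t := by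
      rw [← LinearMap.comp_assoc, LinearEquiv.comp_symm, LinearMap.id_comp]
    rw [ht, ExtAlong.map_comp_apply]
    refine (congrArg _ ?_).trans (map_zero _)
    refine ExtAlong.eq_zero_of_forall_proj _ _ _ fun i => ?_
    have hti : LinearMap.proj i ∘ₗ (Module.piEquiv (Fin m) A C).symm.toLinearMap ∘ₗ t =
        ε (q (Pi.single i 1)) • LinearMap.id := by
      have hc : ∀ c, t c = Module.piEquiv (Fin m) A C fun i => ε (q (Pi.single i 1)) • c :=
        fun c => by
          refine LinearMap.pi_ext' fun i => LinearMap.ext_ring ?_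
          simp [Module.piEquiv_apply_apply, t, s, Pi.single_apply]
      exact LinearMap.ext fun c => by simp [hc]
    rw [← ExtAlong.map_comp_apply, hti]
    exact residueExt_map_smul_eq_zero (hε _ (q (Pi.single i 1)).2) w
  obtain ⟨y, hy⟩ := ExtAlong.exists_map_eq _ _ h1 h2 h3 _ hker
  refine ⟨y, 0, ?_⟩
  rintro rfl
  exact hsw (hy.symm.trans (map_zero _))

end Hom

/-! ### The trivial extension by a semi-dualizing module -/

section TrivialExtension

open Abelian IsLocalRing

variable {A : Type u} [CommRing A]

lemma IsSemidualizing.nontrivial [Nontrivial A] {C : Type u} [AddCommGroup C] [Module A C]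
    (hC : IsSemidualizing A C) : Nontrivial C := by
  by_contra h
  rw [not_nontrivial_iff_subsingleton] at h
  have := hC.bijective.1.subsingleton
  exact not_subsingleton A this

lemma TrivSqZeroExt.isNoetherianRing [IsNoetherianRing A] {C : Type u} [AddCommGroup C]
    [Module A C] [Module Aᵐᵒᵖ C] [IsCentralScalar A C] [Module.Finite A C] :
    IsNoetherianRing (TrivSqZeroExt A C) := by
  have : Module.Finite A (TrivSqZeroExt A C) := inferInstanceAs (Module.Finite A (A × C))
  exact IsNoetherianRing.of_finite A (TrivSqZeroExt A C)

variable [IsLocalRing A]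

lemma moduleDepth_eq {M : Type u} [AddCommGroup M] [Module A M] {t : ℕ}
    (ht : Nontrivial (ResidueExt A M t)) (hlow : ∀ j < t, Subsingleton (ResidueExt A M j)) :
    moduleDepth A M = (t : EReal) := by
  refine IsLeast.csInf_eq ⟨⟨t, ht, rfl⟩, ?_⟩
  rintro _ ⟨i, hi, rfl⟩
  by_contra hlt
  rw [not_le, Nat.cast_lt (α := EReal)] at hlt
  exact not_subsingleton_iff_nontrivial.2 hi (hlow i hlt)

variable {C : Type u} [AddCommGroup C] [Module A C]

/-- A semi-dualizing module `C` has the same depth as the ring `A = Hom(C, C)`. -/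
lemma IsSemidualizing.residueExt_ring [IsNoetherianRing A] (hC : IsSemidualizing A C) {e : ℕ}
    (he : HasSocleDepth (𝟭 (ModuleCat.{u} A)) (ModuleCat.of A (ResidueField A)) C e) :
    (∀ j < e, Subsingleton (ResidueExt A A j)) ∧ Nontrivial (ResidueExt A A e) := by
  have := hC.finite
  have := hC.nontrivial
  have hext : ∀ i : ℕ, Subsingleton (Ext (ModuleCat.of A C) (ModuleCat.of A C) (i + 1)) :=
    fun i => hC.ext_eq_zero (i + 1) (by omega)
  let φ : A ≃ₗ[A] (C →ₗ[A] C) := LinearEquiv.ofBijective (LinearMap.lsmul A C) hC.bijective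
  refine ⟨fun j hj => ExtAlong.subsingleton_of_equiv _ _ j φ.symm
    (subsingleton_residueExt_hom he.subsingleton hj C hext), ?_⟩
  by_contra h
  rw [not_nontrivial_iff_subsingleton] at h
  exact not_subsingleton_iff_nontrivial.2 (nontrivial_residueExt_hom he C hext)
    (ExtAlong.subsingleton_of_equiv _ _ e φ h)

variable [Module Aᵐᵒᵖ C] [IsCentralScalar A C]

instance TrivSqZeroExt.isLocalRing : IsLocalRing (TrivSqZeroExt A C) := by
  have : IsLocalHom (TrivSqZeroExt.fstHom A A C : TrivSqZeroExt A C →+* A) :=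
    ⟨fun x hx => TrivSqZeroExt.isUnit_iff_isUnit_fst.2 hx⟩
  exact RingHom.domain_isLocalRing (TrivSqZeroExt.fstHom A A C : TrivSqZeroExt A C →+* A)

/-- As an `A`-module, `A ⋉ C` is an extension of `A` by `C`, so it has their common depth. The
image in `Ext^e(k, A ⋉ C)` of a nonzero class of `Ext^e(k, C)` is nonzero, and annihilated by the
maximal ideal of `A ⋉ C`: an element `(a, c)` acts on it through `a`. -/
lemma IsSemidualizing.hasSocleDepth_trivSqZeroExt [IsNoetherianRing A] (hC : IsSemidualizing A C)
    {e : ℕ} (he : HasSocleDepth (𝟭 (ModuleCat.{u} A)) (ModuleCat.of A (ResidueField A)) C e) :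
    HasSocleDepth (ModuleCat.restrictScalars.{u} (algebraMap A (TrivSqZeroExt A C)))
      (ModuleCat.of A (ResidueField A)) (TrivSqZeroExt A C) e := by
  let F := ModuleCat.restrictScalars.{u} (algebraMap A (TrivSqZeroExt A C))
  let K := ModuleCat.of A (ResidueField A)
  let R' := F.obj (ModuleCat.of (TrivSqZeroExt A C) (TrivSqZeroExt A C))
  let ι : C →ₗ[A] R' :=
    { toFun := fun c => (TrivSqZeroExt.inr c : TrivSqZeroExt A C)
      map_add' := fun c c' => TrivSqZeroExt.inr_add A c c'
      map_smul' := fun a c => by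
        change (TrivSqZeroExt.inr (a • c) : TrivSqZeroExt A C) =
          TrivSqZeroExt.inl a * TrivSqZeroExt.inr c
        rw [TrivSqZeroExt.inl_mul_inr] }
  let π : R' →ₗ[A] A :=
    { toFun := fun x => TrivSqZeroExt.fst (x : TrivSqZeroExt A C)
      map_add' := fun x y => rfl
      map_smul' := fun a x => TrivSqZeroExt.fst_mul (TrivSqZeroExt.inl a) x }
  have hsnd : ∀ (a : A) (x : TrivSqZeroExt A C),
      (TrivSqZeroExt.inl a * x).snd = a • x.snd := fun a x => by simp
  let σ : R' →ₗ[A] C :=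
    { toFun := fun x => TrivSqZeroExt.snd (x : TrivSqZeroExt A C)
      map_add' := fun x y => rfl
      map_smul' := hsnd }
  have hσι : σ ∘ₗ ι = LinearMap.id := LinearMap.ext fun c => TrivSqZeroExt.snd_inr A c
  have hιπ : Function.Exact ι π := fun x => by
    constructor
    · intro hx
      exact ⟨σ x, TrivSqZeroExt.ext (hx.symm) (TrivSqZeroExt.snd_inr A _)⟩
    · rintro ⟨c, rfl⟩
      exact TrivSqZeroExt.fst_inr A c
  refine ⟨fun j hj => ?_, ?_⟩
  · exact ExtAlong.subsingleton_middle (𝟭 _) K (f := ι) (g := π)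
      (fun c c' h => TrivSqZeroExt.inr_injective h) hιπ
      (fun a => ⟨(TrivSqZeroExt.inl a : TrivSqZeroExt A C), rfl⟩)
      (he.subsingleton j hj) ((hC.residueExt_ring he).1 j hj)
  · obtain ⟨w, hw, hsoc⟩ := he.exists_socle
    have hsoc' : ∀ a ∈ maximalIdeal A, ExtAlong.map (𝟭 _) K e (a • LinearMap.id) w = 0 := hsoc
    refine ⟨ExtAlong.map (𝟭 _) K e ι w, fun h0 => hw ?_, fun r hr => ?_⟩
    · rw [← ExtAlong.map_id_apply (𝟭 _) K e w, ← hσι, ExtAlong.map_comp_apply]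
      exact (congrArg _ h0).trans (map_zero _)
    · let μ : R' →ₗ[A] R' := (F.map (ModuleCat.ofHom (r • LinearMap.id))).hom
      have hμ : μ ∘ₗ ι = ι ∘ₗ (r.fst • LinearMap.id) := LinearMap.ext fun c => by
        change r * TrivSqZeroExt.inr c = (TrivSqZeroExt.inr (r.fst • c) : TrivSqZeroExt A C)
        ext <;> simp
      have hr' : r.fst ∈ maximalIdeal A := by
        rw [mem_maximalIdeal, mem_nonunits_iff] at hr ⊢
        rwa [← TrivSqZeroExt.isUnit_iff_isUnit_fst]
      change ExtAlong.map (𝟭 _) K e μ (ExtAlong.map (𝟭 _) K e ι w) = 0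
      rw [← ExtAlong.map_comp_apply, hμ, ExtAlong.map_comp_apply, hsoc _ hr', map_zero]

lemma exists_minimal_resolution {R : Type u} [CommRing R] {M : Type u} [AddCommGroup M]
    [Module R M] [Nontrivial M] (h : gorensteinProjectiveDim R M < ⊤) :
    ∃ n : ℕ, gorensteinProjectiveDim R M = (n : EReal) ∧ HasGorensteinProjectiveResolution R n M ∧
      ∀ m < n, ¬ HasGorensteinProjectiveResolution R m M := by
  classical
  have hdim : gorensteinProjectiveDim R M = sInf {x : EReal | ∃ n : ℕ,
      HasGorensteinProjectiveResolution R n M ∧ x = (n : EReal)} :=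
    if_neg (not_subsingleton M)
  have hex : ∃ n, HasGorensteinProjectiveResolution R n M := by
    rw [hdim, sInf_lt_iff] at h
    obtain ⟨_, ⟨n, hn, -⟩, -⟩ := h
    exact ⟨n, hn⟩
  refine ⟨Nat.find hex, ?_, Nat.find_spec hex, fun m hm => Nat.find_min hex hm⟩
  rw [hdim]
  refine IsLeast.csInf_eq ⟨⟨_, Nat.find_spec hex, rfl⟩, ?_⟩
  rintro _ ⟨i, hi, rfl⟩
  exact Nat.cast_le.2 (Nat.find_min' hex hi)

/-- The formula for a single semi-dualizing module: `exists_hasSocleDepth` gives the common depth of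
`C` and `A`, and `HasSocleDepth.auslander_buchsbaum` applies to restriction of scalars along
`A → A ⋉ C`, under which `M` becomes the given `A`-module. -/
theorem IsSemidualizing.gorensteinProjectiveDim_eq [IsNoetherianRing A] (hC : IsSemidualizing A C)
    {M : Type u} [AddCommGroup M] [Module A M] [Module.Finite A M] [Nontrivial M]
    [Module (TrivSqZeroExt A C) M] [IsScalarTower A (TrivSqZeroExt A C) M]
    (h : gorensteinProjectiveDim (TrivSqZeroExt A C) M < ⊤) :
    gorensteinProjectiveDim (TrivSqZeroExt A C) M = moduleDepth A A - moduleDepth A M := by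
  have := hC.finite
  have := hC.nontrivial
  have := TrivSqZeroExt.isNoetherianRing (A := A) (C := C)
  have : Module.Finite (TrivSqZeroExt A C) M :=
    Module.Finite.of_restrictScalars_finite A (TrivSqZeroExt A C) M
  obtain ⟨e, he⟩ := exists_hasSocleDepth (A := A) C
  obtain ⟨n, hn, hres, hmin⟩ := exists_minimal_resolution h
  obtain ⟨t, ht, hnt, hlow⟩ := (hC.hasSocleDepth_trivSqZeroExt he).auslander_buchsbaum n hres hmin
  have hsmul : ∀ (a : A) (m : M), algebraMap A (TrivSqZeroExt A C) a • m = a • m :=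
    algebraMap_smul (TrivSqZeroExt A C)
  let M' := (ModuleCat.restrictScalars.{u} (algebraMap A (TrivSqZeroExt A C))).obj
    (ModuleCat.of (TrivSqZeroExt A C) M)
  let φ : M' ≃ₗ[A] M :=
    { toFun := fun m => m
      invFun := fun m => m
      map_add' := fun _ _ => rfl
      map_smul' := hsmul
      left_inv := fun _ => rfl
      right_inv := fun _ => rfl }
  have hM : moduleDepth A M = (t : EReal) := by
    refine moduleDepth_eq ?_ fun j hj =>
      ExtAlong.subsingleton_of_equiv (X := M') (Y := M) (𝟭 _) _ j φ (hlow j hj)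
    by_contra hT
    rw [not_nontrivial_iff_subsingleton] at hT
    exact not_subsingleton_iff_nontrivial.2 hnt
      (ExtAlong.subsingleton_of_equiv (X := M) (Y := M') (𝟭 _) _ t φ.symm hT)
  obtain ⟨hA, hA'⟩ := hC.residueExt_ring he
  rw [hn, hM, moduleDepth_eq hA' hA, ← ht, Nat.cast_add, add_comm]
  exact (EReal.add_sub_cancel_right (a := (n : EReal)) (b := t)).symm

end TrivialExtension

theorem theorem5p5 (A : Type u) [CommRing A] [IsLocalRing A] [IsNoetherianRing A]
    (M : Type u) [AddCommGroup M] [Module A M] [Module.Finite A M]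
    (hM : cohenMacaulayProjectiveDim A M < ⊤) :
    cohenMacaulayProjectiveDim A M = moduleDepth A A - moduleDepth A M := by
  obtain ⟨_, ⟨C, _, _, _, _, hC, rfl⟩, hlt⟩ := sInf_lt_iff.1 hM
  rcases subsingleton_or_nontrivial M with hsub | hnt
  -- for `M = 0` both sides are `-∞`, the right one because `x - ⊤ = ⊥` for all extended reals `x`
  · have hdepth : moduleDepth A M = ⊤ := by
      refine sInf_eq_top.2 ?_
      rintro _ ⟨i, hi, rfl⟩
      exact absurd (ExtAlong.subsingleton_of_subsingleton (𝟭 _) _ i)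
        (not_subsingleton_iff_nontrivial.2 hi)
    rw [hdepth, EReal.sub_top]
    have h0 : ringChangedGpd A C M = ⊥ := if_pos hsub
    exact eq_bot_iff.2 (h0 ▸ sInf_le ⟨C, _, _, ‹_›, ‹_›, hC, rfl⟩)
  · have key : ∀ (C : Type u) [AddCommGroup C] [Module A C] [Module Aᵐᵒᵖ C] [IsCentralScalar A C],
        IsSemidualizing A C → ringChangedGpd A C M < ⊤ →
        ringChangedGpd A C M = moduleDepth A A - moduleDepth A M := by
      intro C _ _ _ _ hC h
      let : Module (TrivSqZeroExt A C) M :=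
        Module.compHom M (TrivSqZeroExt.fstHom A A C : TrivSqZeroExt A C →+* A)
      have : IsScalarTower A (TrivSqZeroExt A C) M :=
        ⟨fun a x m => smul_assoc a x.fst m⟩
      exact hC.gorensteinProjectiveDim_eq h
    refine IsLeast.csInf_eq ⟨⟨C, _, _, _, _, hC, (key C hC hlt).symm⟩, ?_⟩
    rintro _ ⟨C', _, _, _, _, hC', rfl⟩
    rcases lt_or_eq_of_le (le_top (a := ringChangedGpd A C' M)) with h | h
    · exact (key C' hC' h).ge
    · rw [h]
      exact le_top
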